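/- Let $Q$ be a finite tree network with root node $O$: a finite tree whose arcs have positive lengths, regarded as a compact metric space whose points are the nodes and all interior points of arcs, with $d(x,y)$ the length of the path between $x$ and $y$. Let $\lambda$ be the length measure on $Q$. For points $x,y\in Q$ write $x\preceq y$ if $x$ lies on the path between $O$ and $y$, and let $Q_x=\{y\in Q: x\preceq y\}$. A hiding distribution is a Borel probability measure $h$ on $Q$; the search density of a region $R$ with $\lambda(R)>0$ is $\rho(R)=h(R)/\lambda(R)$. The distribution $h$ is monotone if $\rho(Q_x)\le\rho(Q_y)$ for all points $x\preceq y$ with $\lambda(Q_y)>0$. A search is a function $S:[0,\infty)\to Q$ with $S(0)=O$ and $d(S(t_1),S(t_2))\le t_2-t_1$ for all $0\le t_1<t_2$. Its search time for a point $x$ is $T(S,x)=\min\{t\ge 0: S(t)=x\}$ (which is $+\infty$ if $S$ never reaches $x$), its expected search time is $T(S,h)=\int_Q T(S,x)\,dh(x)$, and $S$ is optimal against $h$ if it minimizes $T(S,h)$ among all searches. A depth-first search is a search that traverses at unit speed a sequence of arcs which starts and ends at $O$, traverses every arc exactly once in each direction, and leaves a node by the arc towards the root only if all the other arcs at that node have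 been traversed. The behavior of a search after it has covered $Q$ is disregarded: a search $S$ counts as depth-first if there are a depth-first search $S'$ and a time $M$ such that $S([0,M])=Q$ and $S=S'$ on $[0,M]$. Theorem. Let $h$ be a monotone hiding distribution on a rooted tree network $Q$. Then $h$ is strongly simply searchable: some depth-first search is optimal against $h$, and every search that is optimal against $h$ is depth-first. -/

import Mathlib

open MeasureTheory
open scoped NNReal ENNReal

/-- A finite tree with vertex set `V`, a distinguished root node, and a positive length for each
of its arcs (the values of `len` off the edge set play no role). -/
structure TreeNetwork (V : Type*) where
  graph : SimpleGraph V
  isTree : graph.IsTree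
  root : V
  len : Sym2 V → ℝ
  len_pos : ∀ e ∈ graph.edgeSet, 0 < len e

namespace TreeNetwork

noncomputable section

variable {V : Type*} [Fintype V] [DecidableEq V] (N : TreeNetwork V)

/-- `e` is an arc of the path in the tree from the root to the node `v`. -/
def OnRootPath (e : Sym2 V) (v : V) : Prop :=
  ∃ p : N.graph.Walk N.root v, p.IsPath ∧ e ∈ p.edges

open Classical in
/-- The position of the node `v` in the model of the network in `ℓ¹`: the coordinate with index `e`
is the length of the part of the arc `e` that is on the path from the root to `v`. -/
def nodeVec (v : V) : PiLp 1 (fun _ : Sym2 V => ℝ) :=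
  WithLp.toLp 1 (fun e => if N.OnRootPath e v then N.len e else 0)

/-- The points of the network (nodes as well as interior points of arcs). The arc `uv` is the
segment from the node `u` to the node `v`; only the coordinate with index `uv` varies on it.
For every point, the coordinate with index `e` is the length of the part of the arc `e` that is on
the path from the root to the point. Therefore the `ℓ¹` distance `dist x y`, which is the metric
used on this type, is the length of the path between `x` and `y` in the tree. -/
abbrev Point : Type _ :=
  {x : PiLp 1 (fun _ : Sym2 V => ℝ) //
    ∃ u v : V, (N.graph.Adj u v ∨ u = v) ∧ x ∈ segment ℝ (N.nodeVec u) (N.nodeVec v)}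

/-- A node, as a point of the network. -/
def node (v : V) : N.Point :=
  ⟨N.nodeVec v, v, v, Or.inr rfl, left_mem_segment ℝ _ _⟩

/-- The length measure `λ` on the network (Lebesgue measure on each arc), as the one-dimensional
Hausdorff measure of the metric `d`. -/
def lengthMeasure : Measure N.Point := Measure.hausdorffMeasure 1

/-- `x ⪯ y`: the point `x` is on the shortest path between the root and the point `y`. -/
def Below (x y : N.Point) : Prop :=
  dist (N.node N.root) x + dist x y = dist (N.node N.root) y

/-- The subtree `Q_x = {y | x ⪯ y}` rooted at `x`. -/
def subtreeAt (x : N.Point) : Set N.Point := {y | N.Below x y}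

variable {N}

/-- A search: a path `S : [0, ∞) → Q` that starts at the root and has speed at most one. -/
def IsSearch (S : ℝ≥0 → N.Point) : Prop :=
  S 0 = N.node N.root ∧ LipschitzWith 1 S

/-- The search time `T(S, x) = min {t ≥ 0 | S t = x}`, which is `∞` if `S` never reaches `x`. -/
def searchTime (S : ℝ≥0 → N.Point) (x : N.Point) : ℝ≥0∞ :=
  ⨅ (t : ℝ≥0) (_ : S t = x), (t : ℝ≥0∞)

/-- The expected search time `T(S, h)` against the hiding distribution `h`. -/
def expectedSearchTime (S : ℝ≥0 → N.Point) (h : Measure N.Point) : ℝ≥0∞ :=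
  ∫⁻ x, searchTime S x ∂h

/-- `S` is a search whose expected search time is minimal among all searches. -/
def IsOptimal (h : Measure N.Point) (S : ℝ≥0 → N.Point) : Prop :=
  IsSearch S ∧ ∀ S' : ℝ≥0 → N.Point, IsSearch S' →
    expectedSearchTime S h ≤ expectedSearchTime S' h

/-- The search density `ρ(R) = h(R) / λ(R)` of a region `R` with `λ(R) > 0`. -/
def density (h : Measure N.Point) (R : Set N.Point) : ℝ≥0∞ :=
  h R / N.lengthMeasure R

/-- `h` is monotone: `ρ(Q_x) ≤ ρ(Q_y)` whenever `x ⪯ y`, for all points `x, y` at which these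
densities are defined (that is, `λ(Q_y) > 0`, which implies `λ(Q_x) > 0`). -/
def IsMonotone (h : Measure N.Point) : Prop :=
  ∀ x y : N.Point, N.Below x y → 0 < N.lengthMeasure (N.subtreeAt y) →
    density h (N.subtreeAt x) ≤ density h (N.subtreeAt y)

variable (N) in
/-- A depth-first sequence of arcs: a walk that starts and ends at the root, traverses every arc
exactly once in each direction, and leaves a node by the arc towards the root only if all the other
arcs at that node have already been traversed. -/
def IsDepthFirstWalk (p : N.graph.Walk N.root N.root) : Prop :=
  (∀ u v : V, N.graph.Adj u v →
    ∃! i : ℕ, i < p.length ∧ p.getVert i = u ∧ p.getVert (i + 1) = v) ∧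
  ∀ i < p.length,
    N.graph.dist N.root (p.getVert (i + 1)) < N.graph.dist N.root (p.getVert i) →
    ∀ w : V, N.graph.Adj (p.getVert i) w → w ≠ p.getVert (i + 1) →
      ∃ j < i, s(p.getVert j, p.getVert (j + 1)) = s(p.getVert i, w)

variable (N) in
/-- The time that a walk at unit speed along `p` needs for its first `i` arcs. -/
def arrivalTime (p : N.graph.Walk N.root N.root) (i : ℕ) : ℝ :=
  ∑ j ∈ Finset.range i, N.len s(p.getVert j, p.getVert (j + 1))

/-- A depth-first search: it traverses a depth-first sequence of arcs at unit speed. (What it does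
after having returned to the root at the end of the sequence is irrelevant.) -/
def IsDepthFirst (S : ℝ≥0 → N.Point) : Prop :=
  IsSearch S ∧ ∃ p : N.graph.Walk N.root N.root, N.IsDepthFirstWalk p ∧
    ∀ i < p.length, ∀ t : ℝ≥0, N.arrivalTime p i ≤ t → (t : ℝ) ≤ N.arrivalTime p (i + 1) →
      dist (N.node (p.getVert i)) (S t) = t - N.arrivalTime p i ∧
      dist (S t) (N.node (p.getVert (i + 1))) = N.arrivalTime p (i + 1) - t

/-- `S` coincides with a depth-first search up to a time `M` at which `S` has covered the network.
The behaviour of a search after such a time is irrelevant. -/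
def IsDepthFirstUntilCovering (S : ℝ≥0 → N.Point) : Prop :=
  ∃ S' : ℝ≥0 → N.Point, IsDepthFirst S' ∧
    ∃ M : ℝ≥0, S '' Set.Icc 0 M = Set.univ ∧ ∀ t ≤ M, S t = S' t

/-- Some depth-first search is optimal against `h`. -/
def SimplySearchable (h : Measure N.Point) : Prop :=
  ∃ S : ℝ≥0 → N.Point, IsDepthFirst S ∧ IsOptimal h S

/-- The optimal searches against `h` (there are some) are all depth-first. -/
def StronglySimplySearchable (h : Measure N.Point) : Prop :=
  SimplySearchable h ∧ ∀ S : ℝ≥0 → N.Point, IsOptimal h S → IsDepthFirstUntilCovering S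

end

end TreeNetwork

/-!
The tree is embedded in `ℓ¹`, with one coordinate for every arc, so the distance of two points is
the sum of the differences of their coordinates, and `x ⪯ y` is the coordinatewise order. Write
`Λ` for the total length and `d(x)` for the distance of `x` from the root `O`. The arc below a
node is the arc between the node and its parent.

*Lower bound.* When a search reaches `x` for the first time, at the time `T(x)`, each coordinate
has gone up to its maximum so far and back down to its value at `x`. No time is saved by moving
several coordinates at once (`sum_variation_le`), so `T(x) + d(x) ≥ 2 λ{y | T(y) ≤ T(x)}`
(`two_mul_lengthMeasure_le`). The points `y ⪯ x` contribute `d(x)` to the right side. The other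
pairs `(x, y)` that matter lie on two different branches at a node. If `h` is monotone, then a
branch at a node has the same density as the subtree at that node (`IsMonotone.measure_branch`),
and any upper set in the branch has at least this density (`IsMonotone.density_mul_le`): within a
branch the hider is found later than a point that is uniformly distributed by length. For two
independent points that are uniformly distributed on two branches, either one comes first, so at
least half of the pairs of points on two branches, with respect to `h × λ`, have `T(y) ≤ T(x)`
(`IsMonotone.siblings_le`). Hence no search has an expected search time below `searchValue h`.

*The bound is attained.* A tour is a search that visits all the nodes and is back at `O` at the
time `2Λ`; one is obtained by inserting detours for one leaf after another (`exists_isTour`).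
Between the first and the last visit of `x` a tour traverses the subtree `Q_x` twice, so the
search times of `x` by a tour and by the reversed tour add up to at most `2Λ - 2λ(Q_x)`. This has
mean `2 searchValue h`, so both tours are optimal (`IsTour.expectedSearchTime_le`).

*Tours are depth-first.* A tour has exactly the time to move each coordinate up to its maximum and
back once. So the phases of the arcs, which run from `0` to twice the length of the arc, increase
and add up to the time (`sum_phase`). Every arc is therefore traversed in each direction in a
single run at unit speed, these runs fill the time `[0, 2Λ]`, and after leaving a subtree the tour
does not return to it (`IsTour.isDepthFirst`).

*Optimal searches are beginnings of tours.* Equality in the lower bound gives `T(x) + d(x) ≤ 2Λ`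
for `h`-almost all `x`. All subtrees of positive length have positive measure, so at the last time
`M` with `M + d(S(M)) ≤ 2Λ` the search `S` has covered the network. If it then returns to `O`, it
becomes a tour (`IsMonotone.exists_isTour_of_le`).
-/

namespace TreeNetwork

noncomputable section

open Set Filter Topology

set_option linter.unusedSectionVars false

/-! ### The rooted structure of the tree -/

section Tree

variable {V : Type*} (N : TreeNetwork V)

/-- The path from the root to the node `v`. -/
def rootPath (v : V) : N.graph.Walk N.root v := (N.isTree.existsUnique_path N.root v).choose

lemma rootPath_isPath (v : V) : (N.rootPath v).IsPath :=
  (N.isTree.existsUnique_path N.root v).choose_spec.1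

variable {N} in
lemma eq_rootPath {v : V} {p : N.graph.Walk N.root v} (hp : p.IsPath) : p = N.rootPath v :=
  (N.isTree.existsUnique_path N.root v).choose_spec.2 p hp

/-- The parent of a node: the neighbour on the path to the root. The root is its own parent. -/
def par (v : V) : V := (N.rootPath v).penultimate

/-- The number of arcs on the path between a node and the root. -/
def depth (v : V) : ℕ := N.graph.dist N.root v

lemma rootPath_root : N.rootPath N.root = SimpleGraph.Walk.nil :=
  (eq_rootPath SimpleGraph.Walk.IsPath.nil).symm

lemma par_root : N.par N.root = N.root := by
  simp [par, rootPath_root]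

variable {N}

lemma par_adj {v : V} (hv : v ≠ N.root) : N.graph.Adj (N.par v) v :=
  SimpleGraph.Walk.adj_penultimate (fun h => hv h.eq.symm)

lemma par_ne {v : V} (hv : v ≠ N.root) : N.par v ≠ v := (par_adj hv).ne

lemma rootPath_eq_concat {v : V} (hv : v ≠ N.root) :
    N.rootPath v = (N.rootPath (N.par v)).concat (par_adj hv) := by
  have h : N.rootPath (N.par v) = (N.rootPath v).dropLast :=
    (eq_rootPath (N.rootPath_isPath v).dropLast).symm
  rw [h]
  exact (SimpleGraph.Walk.concat_dropLast _).symm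

lemma adj_cases {a b : V} (hab : N.graph.Adj a b) :
    (b ≠ N.root ∧ N.par b = a) ∨ (a ≠ N.root ∧ N.par a = b) := by
  by_cases hb : b ∈ (N.rootPath a).support
  · right
    refine ⟨?_, (N.isTree.isAcyclic.eq_penultimate_of_adj_end (N.rootPath_isPath a) hab hb).symm⟩
    rintro rfl
    rw [rootPath_root] at hb
    simp at hb
    exact hab.ne hb.symm
  · left
    have h := eq_rootPath ((N.rootPath_isPath a).concat hb hab)
    refine ⟨?_, ?_⟩
    · rintro rfl
      exact hb (N.rootPath a).start_mem_support
    · rw [par, ← h, SimpleGraph.Walk.penultimate_concat]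

lemma depth_eq (v : V) : N.depth v = (N.rootPath v).length := by
  obtain ⟨p, hp, hl⟩ := N.isTree.connected.exists_path_of_dist N.root v
  rw [depth, ← hl, eq_rootPath hp]

lemma depth_par {v : V} (hv : v ≠ N.root) : N.depth v = N.depth (N.par v) + 1 := by
  rw [depth_eq, depth_eq, rootPath_eq_concat hv, SimpleGraph.Walk.length_concat]

variable (N) in
/-- Induction from the root to the leaves. -/
lemma par_induction {P : V → Prop} (root : P N.root)
    (step : ∀ v, v ≠ N.root → P (N.par v) → P v) (v : V) : P v := by
  induction h : N.depth v using Nat.strong_induction_on generalizing v with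
  | _ n ih =>
    by_cases hv : v = N.root
    · exact hv ▸ root
    · exact step v hv (ih _ (by rw [← h, depth_par hv]; omega) _ rfl)

lemma parEdge_mem {v : V} (hv : v ≠ N.root) : s(N.par v, v) ∈ N.graph.edgeSet := par_adj hv

lemma parEdge_injective {v w : V} (hv : v ≠ N.root) (hw : w ≠ N.root)
    (h : s(N.par v, v) = s(N.par w, w)) : v = w := by
  rcases Sym2.eq_iff.1 h with h | h
  · exact h.2
  · have h1 := depth_par hv
    have h2 := depth_par hw
    rw [h.1] at h1
    rw [← h.2] at h2
    omega

lemma exists_parEdge {e : Sym2 V} (he : e ∈ N.graph.edgeSet) :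
    ∃ v, v ≠ N.root ∧ e = s(N.par v, v) := by
  induction e with
  | _ a b =>
    rcases adj_cases (SimpleGraph.mem_edgeSet _ |>.1 he) with h | h
    · exact ⟨b, h.1, by rw [h.2]⟩
    · exact ⟨a, h.1, by rw [h.2, Sym2.eq_swap]⟩

lemma onRootPath_iff {e : Sym2 V} {v : V} : N.OnRootPath e v ↔ e ∈ (N.rootPath v).edges := by
  constructor
  · rintro ⟨p, hp, h⟩
    rwa [← eq_rootPath hp]
  · exact fun h => ⟨_, N.rootPath_isPath v, h⟩

variable (N) in
/-- `w` is a node other than the root that is on the path from the root to `v` (possibly `v`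
itself); equivalently, the arc between `w` and its parent is on this path. -/
def Anc (w v : V) : Prop := w ≠ N.root ∧ N.OnRootPath s(N.par w, w) v

lemma not_anc_root (w : V) : ¬ N.Anc w N.root := by
  rintro ⟨-, h⟩
  rw [onRootPath_iff, rootPath_root] at h
  simp at h

lemma anc_iff {w v : V} (hv : v ≠ N.root) : N.Anc w v ↔ w = v ∨ N.Anc w (N.par v) := by
  unfold Anc
  rw [onRootPath_iff, onRootPath_iff, rootPath_eq_concat hv, SimpleGraph.Walk.edges_concat]
  simp only [List.concat_eq_append, List.mem_append, List.mem_singleton]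
  constructor
  · rintro ⟨hw, h | h⟩
    · exact Or.inr ⟨hw, h⟩
    · exact Or.inl (parEdge_injective hw hv h)
  · rintro (rfl | h)
    · exact ⟨hv, Or.inr rfl⟩
    · exact ⟨h.1, Or.inl h.2⟩

lemma anc_self {v : V} (hv : v ≠ N.root) : N.Anc v v := (anc_iff hv).2 (Or.inl rfl)

lemma Anc.depth_le {w v : V} : N.Anc w v → N.depth w ≤ N.depth v := by
  refine N.par_induction (P := fun v => N.Anc w v → N.depth w ≤ N.depth v) ?_ ?_ v
  · exact fun h => (not_anc_root _ h).elim
  · intro v hv ih h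
    rcases (anc_iff hv).1 h with rfl | h
    · exact le_rfl
    · rw [depth_par hv]
      exact (ih h).trans (Nat.le_succ _)

lemma not_anc_par {v : V} (hv : v ≠ N.root) : ¬ N.Anc v (N.par v) := fun h => by
  have := h.depth_le
  rw [depth_par hv] at this
  omega

lemma Anc.trans {u w v : V} (h1 : N.Anc u w) : N.Anc w v → N.Anc u v := by
  refine N.par_induction (P := fun v => N.Anc w v → N.Anc u v) ?_ ?_ v
  · exact fun h => (not_anc_root _ h).elim
  · intro v hv ih h
    rcases (anc_iff hv).1 h with rfl | h
    · exact h1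
    · exact (anc_iff hv).2 (Or.inr (ih h))

lemma Anc.comparable {u w v : V} : N.Anc u v → N.Anc w v → N.Anc u w ∨ N.Anc w u := by
  refine N.par_induction (P := fun v => N.Anc u v → N.Anc w v → N.Anc u w ∨ N.Anc w u) ?_ ?_ v
  · exact fun h => (not_anc_root _ h).elim
  · intro v hv ih h1 h2
    rcases (anc_iff hv).1 h1 with rfl | h1'
    · exact Or.inr h2
    · rcases (anc_iff hv).1 h2 with rfl | h2'
      · exact Or.inl h1
      · exact ih h1' h2'

lemma Anc.antisymm {u w : V} (h1 : N.Anc u w) (h2 : N.Anc w u) : u = w := by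
  by_contra hne
  have h := (anc_iff h2.1).1 h1
  rcases h with h | h
  · exact hne h
  · exact not_anc_par h2.1 (h2.trans h)

/-- Two different nodes with the same parent. -/
def Siblings (N : TreeNetwork V) (v w : V) : Prop :=
  v ≠ N.root ∧ w ≠ N.root ∧ v ≠ w ∧ N.par v = N.par w

lemma Siblings.symm {v w : V} (h : N.Siblings v w) : N.Siblings w v :=
  ⟨h.2.1, h.1, h.2.2.1.symm, h.2.2.2.symm⟩

lemma Siblings.not_anc {v w : V} (h : N.Siblings v w) : ¬ N.Anc v w := fun ha => by
  rcases (anc_iff h.2.1).1 ha with h' | h'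
  · exact h.2.2.1 h'
  · rw [← h.2.2.2] at h'
    exact not_anc_par h.1 h'

/-- A node strictly above `u` is on the branch at `u` that belongs to one of the children. -/
lemma exists_child_anc {u : V} {v : V} :
    (u = N.root ∨ N.Anc u v) → v ≠ u → ∃ w, w ≠ N.root ∧ N.par w = u ∧ N.Anc w v := by
  refine N.par_induction
    (P := fun v => (u = N.root ∨ N.Anc u v) → v ≠ u → ∃ w, w ≠ N.root ∧ N.par w = u ∧ N.Anc w v)
    ?_ ?_ v
  · rintro (h | h) hne
    · exact (hne h.symm).elim
    · exact (not_anc_root _ h).elim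
  · intro v hv ih h hne
    by_cases hp : N.par v = u
    · exact ⟨v, hv, hp, anc_self hv⟩
    · have h' : u = N.root ∨ N.Anc u (N.par v) := by
        refine h.imp_right fun h => ?_
        exact ((anc_iff hv).1 h).resolve_left (Ne.symm hne)
      obtain ⟨w, hw, hwu, ha⟩ := ih h' hp
      exact ⟨w, hw, hwu, (anc_iff hv).2 (Or.inr ha)⟩

/-- Two nodes are comparable, or they are on different branches at some node. -/
lemma anc_trichotomy (u v : V) :
    (u = N.root ∨ N.Anc u v) ∨ (v = N.root ∨ N.Anc v u) ∨
      ∃ a b, N.Siblings a b ∧ N.Anc a u ∧ N.Anc b v := by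
  refine N.par_induction (P := fun v => (u = N.root ∨ N.Anc u v) ∨ (v = N.root ∨ N.Anc v u) ∨
    ∃ a b, N.Siblings a b ∧ N.Anc a u ∧ N.Anc b v) ?_ ?_ v
  · exact Or.inr (Or.inl (Or.inl rfl))
  · rintro v hv (h | h | ⟨a, b, hs, ha, hb⟩)
    · exact Or.inl (h.imp_right fun h => (anc_iff hv).2 (Or.inr h))
    · by_cases hu : u = N.par v
      · refine Or.inl ?_
        by_cases hr : u = N.root
        · exact Or.inl hr
        · exact Or.inr ((anc_iff hv).2 (Or.inr (hu ▸ anc_self hr)))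
      · obtain ⟨w, hw, hwv, ha⟩ := exists_child_anc h hu
        by_cases hwe : w = v
        · exact Or.inr (Or.inl (Or.inr (hwe ▸ ha)))
        · exact Or.inr (Or.inr ⟨w, v, ⟨hw, hv, hwe, hwv⟩, ha, anc_self hv⟩)
    · exact Or.inr (Or.inr ⟨a, b, hs, ha, (anc_iff hv).2 (Or.inr hb)⟩)

end Tree

/-! ### Points of the network in coordinates -/

section Points

variable {V : Type*} [Fintype V] [DecidableEq V] (N : TreeNetwork V)

/-- The length of the arc between the node `v` and its parent, and `0` if `v` is the root. -/
def arcLen (v : V) : ℝ := if v = N.root then 0 else N.len s(N.par v, v)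

/-- The length of the part of the arc between `v` and its parent that is on the path from the root
to the point `x`. -/
def coord (v : V) (x : N.Point) : ℝ := x.1 s(N.par v, v)

lemma arcLen_root : N.arcLen N.root = 0 := by simp [arcLen]

variable {N} in
lemma arcLen_pos {v : V} (hv : v ≠ N.root) : 0 < N.arcLen v := by
  rw [arcLen, if_neg hv]
  exact N.len_pos _ (parEdge_mem hv)

lemma arcLen_nonneg (v : V) : 0 ≤ N.arcLen v := by
  by_cases hv : v = N.root
  · rw [hv, arcLen_root]
  · exact (arcLen_pos hv).le

/-- The retraction of `ℝ` onto the interval that parametrizes the arc below `v`. -/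
def clamp (v : V) (r : ℝ) : ℝ := max 0 (min r (N.arcLen v))

lemma clamp_nonneg (v : V) (r : ℝ) : 0 ≤ N.clamp v r := le_max_left _ _

lemma clamp_le (v : V) (r : ℝ) : N.clamp v r ≤ N.arcLen v :=
  max_le (N.arcLen_nonneg v) (min_le_right _ _)

variable {N} in
lemma clamp_eq {v : V} {r : ℝ} (h0 : 0 ≤ r) (h1 : r ≤ N.arcLen v) : N.clamp v r = r := by
  rw [clamp, min_eq_left h1, max_eq_right h0]

lemma clamp_root (r : ℝ) : N.clamp N.root r = 0 :=
  le_antisymm ((N.clamp_le _ _).trans (N.arcLen_root).le) (N.clamp_nonneg _ _)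

/-- The point at distance `r` from the parent of `v` on the arc between `v` and its parent. Values
`r` outside of the arc are moved to the nearest end of the arc; for the root the arc is
degenerate. -/
def arc (v : V) (r : ℝ) : N.Point :=
  ⟨AffineMap.lineMap (N.nodeVec (N.par v)) (N.nodeVec v) (N.clamp v r / N.arcLen v),
    N.par v, v, by
      by_cases hv : v = N.root
      · exact Or.inr (hv ▸ N.par_root)
      · exact Or.inl (par_adj hv), by
      rw [segment_eq_image_lineMap]
      refine ⟨_, ⟨div_nonneg (N.clamp_nonneg _ _) (N.arcLen_nonneg _), ?_⟩, rfl⟩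
      exact div_le_one_of_le₀ (N.clamp_le _ _) (N.arcLen_nonneg _)⟩

open Classical in
lemma coord_node (w v : V) : N.coord w (N.node v) = if N.Anc w v then N.arcLen w else 0 := by
  have h : N.coord w (N.node v) = if N.OnRootPath s(N.par w, w) v then N.len s(N.par w, w) else 0 :=
    rfl
  by_cases hw : w = N.root
  · have hn : ¬ N.OnRootPath s(N.par w, w) v := by
      rw [hw, N.par_root, onRootPath_iff]
      intro h
      exact N.graph.loopless.irrefl _ (SimpleGraph.Walk.edges_subset_edgeSet _ h)
    have hn' : ¬ N.Anc w v := fun h => hn h.2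
    rw [h, if_neg hn, if_neg hn']
  · have hi : N.OnRootPath s(N.par w, w) v ↔ N.Anc w v := ⟨fun h => ⟨hw, h⟩, fun h => h.2⟩
    simp only [h, hi, arcLen, if_neg hw]

open Classical in
/-- The coordinates of a point of an arc. -/
lemma coord_arc (w v : V) (r : ℝ) :
    N.coord w (N.arc v r) = if w = v then N.clamp v r else if N.Anc w v then N.arcLen w else 0 := by
  have h : N.coord w (N.arc v r) = N.coord w (N.node (N.par v)) +
      N.clamp v r / N.arcLen v * (N.coord w (N.node v) - N.coord w (N.node (N.par v))) := by
    simp [coord, arc, node, AffineMap.lineMap_apply]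
    ring
  rw [h, coord_node, coord_node]
  by_cases hv : v = N.root
  · have hn : ¬ N.Anc w N.root := not_anc_root w
    subst hv
    simp [hn, N.par_root, clamp_root]
  · by_cases hwv : w = v
    · subst hwv
      simp [not_anc_par hv, anc_self hv, (arcLen_pos hv).ne']
    · have : N.Anc w v ↔ N.Anc w (N.par v) := by simp [anc_iff hv, hwv]
      simp [this, hwv]

lemma parEdge_injective' : Function.Injective (fun v : V => s(N.par v, v)) := by
  intro v w h
  simp only at h
  by_cases hv : v = N.root
  · subst hv
    rw [N.par_root, Sym2.eq_iff] at h
    tauto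
  · by_cases hw : w = N.root
    · subst hw
      rw [N.par_root, Sym2.eq_iff] at h
      tauto
    · exact parEdge_injective hv hw h

lemma apply_eq_zero {e : Sym2 V} (he : e ∉ N.graph.edgeSet) (x : N.Point) : x.1 e = 0 := by
  have hn : ∀ v, N.nodeVec v e = 0 := by
    intro v
    have : ¬ N.OnRootPath e v := by
      rw [onRootPath_iff]
      exact fun h => he (SimpleGraph.Walk.edges_subset_edgeSet _ h)
    simp [nodeVec, this]
  obtain ⟨x, u, v, -, a, b, -, -, -, rfl⟩ := x
  simp [hn]

variable {N}

/-- The distance of two points is the sum of the differences of their coordinates. -/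
lemma dist_eq_sum_coord (x y : N.Point) : dist x y = ∑ v, |N.coord v x - N.coord v y| := by
  rw [Subtype.dist_eq, PiLp.dist_eq_of_L1]
  symm
  refine Finset.sum_of_injOn (fun v : V => s(N.par v, v)) (N.parEdge_injective'.injOn) ?_ ?_ ?_
  · simp
  · intro e _ he
    have : e ∉ N.graph.edgeSet := by
      intro h
      obtain ⟨v, -, rfl⟩ := exists_parEdge h
      exact he ⟨v, by simp, rfl⟩
    rw [N.apply_eq_zero this, N.apply_eq_zero this, dist_self]
  · intro v _
    rw [Real.dist_eq]
    rfl

lemma point_ext {x y : N.Point} (h : ∀ v, N.coord v x = N.coord v y) : x = y := by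
  rw [← dist_eq_zero, dist_eq_sum_coord]
  simp [h]

lemma node_eq_arc (v : V) : N.node v = N.arc v (N.arcLen v) := by
  classical
  refine point_ext fun w => ?_
  rw [coord_node, coord_arc, clamp_eq (N.arcLen_nonneg v) le_rfl]
  by_cases hwv : w = v
  · subst hwv
    by_cases hw : w = N.root
    · simp [hw, arcLen_root]
    · simp [anc_self hw]
  · simp [hwv]

lemma arc_zero (v : V) : N.arc v 0 = N.node (N.par v) := by
  classical
  refine point_ext fun w => ?_
  rw [coord_node, coord_arc, clamp_eq le_rfl (N.arcLen_nonneg v)]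
  by_cases hv : v = N.root
  · subst hv
    simp [not_anc_root, N.par_root]
  · by_cases hwv : w = v
    · subst hwv
      simp [not_anc_par hv]
    · simp [hwv, anc_iff hv]

lemma exists_arc_of_segment {v : V} (hv : v ≠ N.root) {x : N.Point}
    (hx : x.1 ∈ segment ℝ (N.nodeVec (N.par v)) (N.nodeVec v)) :
    ∃ r, 0 ≤ r ∧ r ≤ N.arcLen v ∧ x = N.arc v r := by
  rw [segment_eq_image_lineMap] at hx
  obtain ⟨c, ⟨h0, h1⟩, hc⟩ := hx
  have hl := arcLen_pos hv
  refine ⟨c * N.arcLen v, by positivity, by nlinarith, Subtype.ext ?_⟩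
  have hcl : N.clamp v (c * N.arcLen v) / N.arcLen v = c := by
    rw [clamp_eq (by positivity) (by nlinarith), mul_div_cancel_right₀ _ hl.ne']
  rw [← hc, arc]
  exact congrArg _ hcl.symm

/-- Every point other than the root is on a half-open arc from the parent of a node, exclusive, to
the node, inclusive. -/
lemma point_cases (x : N.Point) :
    x = N.node N.root ∨ ∃ v r, v ≠ N.root ∧ 0 < r ∧ r ≤ N.arcLen v ∧ x = N.arc v r := by
  have key : ∃ v r, 0 ≤ r ∧ r ≤ N.arcLen v ∧ x = N.arc v r := by
    obtain ⟨u, v, huv | rfl, hx⟩ := x.2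
    · rcases adj_cases huv with h | h
      · rw [← h.2] at hx
        exact ⟨v, exists_arc_of_segment h.1 hx⟩
      · rw [← h.2, segment_symm] at hx
        exact ⟨u, exists_arc_of_segment h.1 hx⟩
    · rw [segment_same] at hx
      exact ⟨u, N.arcLen u, N.arcLen_nonneg u, le_rfl, by rw [← node_eq_arc]; exact Subtype.ext hx⟩
  -- The lower end of an arc is the upper end of another arc.
  have hnode : ∀ v, N.node v = N.node N.root ∨
      ∃ w r, w ≠ N.root ∧ 0 < r ∧ r ≤ N.arcLen w ∧ N.node v = N.arc w r := by
    intro v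
    by_cases hv : v = N.root
    · exact Or.inl (by rw [hv])
    · exact Or.inr ⟨v, N.arcLen v, hv, arcLen_pos hv, le_rfl, node_eq_arc v⟩
  obtain ⟨v, r, h0, h1, rfl⟩ := key
  rcases h0.eq_or_lt with rfl | h0
  · rw [arc_zero]
    exact hnode _
  · refine Or.inr ⟨v, r, ?_, h0, h1, rfl⟩
    rintro rfl
    rw [arcLen_root] at h1
    exact absurd h0 h1.not_gt

lemma coord_arc_self {v : V} {r : ℝ} (h0 : 0 ≤ r) (h1 : r ≤ N.arcLen v) :
    N.coord v (N.arc v r) = r := by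
  classical
  rw [coord_arc, if_pos rfl, clamp_eq h0 h1]

lemma coord_arc_of_anc {w v : V} (hne : w ≠ v) (h : N.Anc w v) (r : ℝ) :
    N.coord w (N.arc v r) = N.arcLen w := by
  classical
  rw [coord_arc, if_neg hne, if_pos h]

lemma coord_arc_of_not_anc {w v : V} (hne : w ≠ v) (h : ¬ N.Anc w v) (r : ℝ) :
    N.coord w (N.arc v r) = 0 := by
  classical
  rw [coord_arc, if_neg hne, if_neg h]

lemma coord_node_root (v : V) : N.coord v (N.node N.root) = 0 := by
  classical
  rw [coord_node, if_neg (not_anc_root v)]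

lemma coord_node_self (v : V) : N.coord v (N.node v) = N.arcLen v := by
  rw [node_eq_arc, coord_arc_self (N.arcLen_nonneg v) le_rfl]

lemma coord_nonneg (v : V) (x : N.Point) : 0 ≤ N.coord v x := by
  classical
  rcases point_cases x with rfl | ⟨u, r, hu, h0, h1, rfl⟩
  · rw [coord_node_root]
  · rw [coord_arc]
    split_ifs
    exacts [N.clamp_nonneg _ _, N.arcLen_nonneg _, le_rfl]

lemma coord_le (v : V) (x : N.Point) : N.coord v x ≤ N.arcLen v := by
  classical
  rcases point_cases x with rfl | ⟨u, r, hu, h0, h1, rfl⟩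
  · rw [coord_node_root]
    exact N.arcLen_nonneg v
  · rw [coord_arc]
    split_ifs with h
    exacts [h ▸ N.clamp_le _ _, le_rfl, N.arcLen_nonneg _]

lemma coord_root (x : N.Point) : N.coord N.root x = 0 :=
  le_antisymm ((coord_le _ _).trans N.arcLen_root.le) (coord_nonneg _ _)

lemma ne_root_of_coord_pos {v : V} {x : N.Point} (h : 0 < N.coord v x) : v ≠ N.root := by
  rintro rfl
  exact h.ne' (coord_root x)

/-- The coordinates that are positive at a point of the arc below `v` belong to the nodes on the
path from the root to `v`. -/
lemma anc_of_coord_arc_pos {w v : V} {r : ℝ} (hv : v ≠ N.root) (h : 0 < N.coord w (N.arc v r)) :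
    N.Anc w v := by
  classical
  rw [coord_arc] at h
  split_ifs at h with h1 h2
  · rw [h1]
    exact anc_self hv
  · exact h2
  · exact absurd h (lt_irrefl _)

lemma coord_arc_pos {w v : V} {r : ℝ} (h0 : 0 < r) (h : N.Anc w v) (h1 : r ≤ N.arcLen v) :
    0 < N.coord w (N.arc v r) := by
  by_cases hwv : w = v
  · subst hwv
    rwa [coord_arc_self h0.le h1]
  · rw [coord_arc_of_anc hwv h]
    exact arcLen_pos h.1

/-- A point on the branch of `v` is past the whole arc below any other node `w` on the path from the
root to `v`. -/
lemma coord_eq_arcLen {w v : V} {x : N.Point} (hx : 0 < N.coord v x) (h : N.Anc w v)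
    (hne : w ≠ v) : N.coord w x = N.arcLen w := by
  rcases point_cases x with rfl | ⟨u, r, hu, h0, h1, rfl⟩
  · rw [coord_node_root] at hx
    exact absurd hx (lt_irrefl _)
  · have hvu := anc_of_coord_arc_pos hu hx
    refine coord_arc_of_anc ?_ (h.trans hvu) r
    rintro rfl
    exact hne (h.antisymm hvu)

lemma anc_or_anc_of_coord_pos {w v : V} {x : N.Point} (hv : 0 < N.coord v x)
    (hw : 0 < N.coord w x) : N.Anc v w ∨ N.Anc w v := by
  rcases point_cases x with rfl | ⟨u, r, hu, h0, h1, rfl⟩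
  · rw [coord_node_root] at hv
    exact absurd hv (lt_irrefl _)
  · exact (anc_of_coord_arc_pos hu hv).comparable (anc_of_coord_arc_pos hu hw)

lemma Siblings.coord_eq_zero {v w : V} (h : N.Siblings v w) {x : N.Point} (hv : 0 < N.coord v x) :
    N.coord w x = 0 := by
  by_contra hne
  rcases anc_or_anc_of_coord_pos hv ((coord_nonneg w x).lt_of_ne' hne) with h' | h'
  · exact h.not_anc h'
  · exact h.symm.not_anc h'

/-- A coordinate with a value strictly between its bounds determines the point. -/
lemma eq_arc_of_coord {v : V} {x : N.Point} (h0 : 0 < N.coord v x)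
    (h1 : N.coord v x < N.arcLen v) : x = N.arc v (N.coord v x) := by
  rcases point_cases x with rfl | ⟨u, r, hu, hr0, hr1, rfl⟩
  · rw [coord_node_root] at h0
    exact absurd h0 (lt_irrefl _)
  · have hvu := anc_of_coord_arc_pos hu h0
    by_cases hne : v = u
    · subst hne
      rw [coord_arc_self hr0.le hr1]
    · rw [coord_arc_of_anc hne hvu] at h1
      exact absurd h1 (lt_irrefl _)

lemma dist_root (x : N.Point) : dist (N.node N.root) x = ∑ v, N.coord v x := by
  rw [dist_eq_sum_coord]
  refine Finset.sum_congr rfl fun v _ => ?_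
  rw [coord_node_root, zero_sub, abs_neg, abs_of_nonneg (coord_nonneg v x)]

lemma below_iff {x y : N.Point} : N.Below x y ↔ ∀ v, N.coord v x ≤ N.coord v y := by
  unfold Below
  rw [dist_root, dist_root, dist_eq_sum_coord, ← Finset.sum_add_distrib, eq_comm,
    Finset.sum_eq_sum_iff_of_le]
  · refine ⟨fun h v => ?_, fun h v _ => ?_⟩
    · have := h v (Finset.mem_univ v)
      linarith [abs_nonneg (N.coord v x - N.coord v y)]
    · rw [abs_of_nonpos (by linarith [h v])]
      ring
  · intro v _
    linarith [neg_abs_le (N.coord v x - N.coord v y)]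

lemma Below.trans {x y z : N.Point} (h1 : N.Below x y) (h2 : N.Below y z) : N.Below x z :=
  below_iff.2 fun v => (below_iff.1 h1 v).trans (below_iff.1 h2 v)

lemma Below.refl (x : N.Point) : N.Below x x := below_iff.2 fun _ => le_rfl

lemma Below.antisymm {x y : N.Point} (h1 : N.Below x y) (h2 : N.Below y x) : x = y :=
  point_ext fun v => (below_iff.1 h1 v).antisymm (below_iff.1 h2 v)

lemma root_below (x : N.Point) : N.Below (N.node N.root) x :=
  below_iff.2 fun v => (coord_node_root v).trans_le (coord_nonneg v x)

/-- Whether a point of an arc is on the path to `y` can be read off from one coordinate of `y`. -/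
lemma arc_below_iff {v : V} {r : ℝ} (h0 : 0 < r) (h1 : r ≤ N.arcLen v) {y : N.Point} :
    N.Below (N.arc v r) y ↔ r ≤ N.coord v y := by
  constructor
  · intro h
    have := below_iff.1 h v
    rwa [coord_arc_self h0.le h1] at this
  · intro h
    have hv : v ≠ N.root := ne_root_of_coord_pos (h0.trans_le h)
    refine below_iff.2 fun w => ?_
    by_cases hwv : w = v
    · subst hwv
      rwa [coord_arc_self h0.le h1]
    · by_cases ha : N.Anc w v
      · rw [coord_arc_of_anc hwv ha, coord_eq_arcLen (h0.trans_le h) ha hwv]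
      · rw [coord_arc_of_not_anc hwv ha]
        exact coord_nonneg _ _

lemma node_below_iff {v : V} (hv : v ≠ N.root) {y : N.Point} :
    N.Below (N.node v) y ↔ N.coord v y = N.arcLen v := by
  rw [node_eq_arc, arc_below_iff (arcLen_pos hv) le_rfl]
  exact ⟨fun h => (coord_le v y).antisymm h, fun h => h.ge⟩

lemma arc_below_node (v : V) (r : ℝ) : N.Below (N.arc v r) (N.node v) := by
  classical
  refine below_iff.2 fun w => ?_
  rw [node_eq_arc, coord_arc, coord_arc]
  split_ifs with h1 h2
  · rw [clamp_eq (N.arcLen_nonneg v) le_rfl]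
    exact N.clamp_le v r
  · exact le_rfl
  · exact le_rfl

lemma exists_below_node (x : N.Point) : ∃ v, N.Below x (N.node v) := by
  rcases point_cases x with rfl | ⟨v, r, -, -, -, rfl⟩
  · exact ⟨N.root, Below.refl _⟩
  · exact ⟨v, arc_below_node v r⟩

lemma abs_clamp_sub_le (v : V) (r s : ℝ) : |N.clamp v r - N.clamp v s| ≤ |r - s| := by
  unfold clamp
  exact (abs_max_sub_max_le_abs _ _ 0 |>.trans_eq' (by rw [max_comm 0, max_comm 0])).trans
    (abs_min_sub_min_le_max _ _ _ _ |>.trans (by simp))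

lemma dist_arc (v : V) (r s : ℝ) :
    dist (N.arc v r) (N.arc v s) = |N.clamp v r - N.clamp v s| := by
  classical
  rw [dist_eq_sum_coord, Finset.sum_eq_single v]
  · simp [coord_arc]
  · intro w _ hw
    simp [coord_arc, hw]
  · simp

lemma dist_arc_of_mem {v : V} {r s : ℝ} (hr : r ∈ Icc 0 (N.arcLen v))
    (hs : s ∈ Icc 0 (N.arcLen v)) : dist (N.arc v r) (N.arc v s) = |r - s| := by
  rw [dist_arc, clamp_eq hr.1 hr.2, clamp_eq hs.1 hs.2]

lemma lipschitzWith_arc (v : V) : LipschitzWith 1 (N.arc v) :=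
  LipschitzWith.of_dist_le_mul fun r s => by
    rw [dist_arc, NNReal.coe_one, one_mul, Real.dist_eq]
    exact abs_clamp_sub_le v r s

lemma abs_coord_sub_le (v : V) (x y : N.Point) : |N.coord v x - N.coord v y| ≤ dist x y := by
  rw [dist_eq_sum_coord]
  exact Finset.single_le_sum (f := fun v => |N.coord v x - N.coord v y|)
    (fun _ _ => abs_nonneg _) (Finset.mem_univ v)

lemma lipschitzWith_coord (v : V) : LipschitzWith 1 (N.coord v) :=
  LipschitzWith.of_dist_le_mul fun x y => by
    rw [NNReal.coe_one, one_mul, Real.dist_eq]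
    exact abs_coord_sub_le v x y

@[fun_prop]
lemma continuous_coord (v : V) : Continuous (N.coord v) := (lipschitzWith_coord v).continuous

lemma node_injective : Function.Injective N.node := by
  intro u v h
  have key : ∀ u v, N.node u = N.node v → u = N.root ∨ N.Anc u v := by
    classical
    intro u v h
    by_cases hu : u = N.root
    · exact Or.inl hu
    · have h1 := congrArg (N.coord u) h
      rw [coord_node_self, coord_node] at h1
      split_ifs at h1 with h2
      · exact Or.inr h2
      · exact absurd h1 (arcLen_pos hu).ne'
  rcases key u v h with h1 | h1 <;> rcases key v u h.symm with h2 | h2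
  · rw [h1, h2]
  · exact (not_anc_root _ (h1 ▸ h2)).elim
  · exact (not_anc_root _ (h2 ▸ h1)).elim
  · exact h1.antisymm h2

/-- Two points are comparable, or they are on the branches of two siblings. -/
lemma below_trichotomy (x y : N.Point) : N.Below x y ∨ N.Below y x ∨
    ∃ v w, N.Siblings v w ∧ 0 < N.coord v x ∧ 0 < N.coord w y := by
  rcases point_cases x with rfl | ⟨u, r, hu, hr0, hr1, rfl⟩
  · exact Or.inl (root_below y)
  rcases point_cases y with rfl | ⟨v, s, hv, hs0, hs1, rfl⟩
  · exact Or.inr (Or.inl (root_below _))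
  by_cases huv : u = v
  · subst huv
    rcases le_total r s with h | h
    · exact Or.inl ((arc_below_iff hr0 hr1).2 (by rwa [coord_arc_self hs0.le hs1]))
    · exact Or.inr (Or.inl ((arc_below_iff hs0 hs1).2 (by rwa [coord_arc_self hr0.le hr1])))
  · rcases anc_trichotomy (N := N) u v with (h | h) | (h | h) | ⟨a, b, hs, ha, hb⟩
    · exact absurd h hu
    · exact Or.inl ((arc_below_iff hr0 hr1).2 (by rwa [coord_arc_of_anc huv h]))
    · exact absurd h hv
    · exact Or.inr (Or.inl ((arc_below_iff hs0 hs1).2 (by rwa [coord_arc_of_anc (Ne.symm huv) h])))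
    · exact Or.inr (Or.inr ⟨a, b, hs, coord_arc_pos hr0 ha hr1, coord_arc_pos hs0 hb hs1⟩)

/-- The pair of siblings in `below_trichotomy` is unique. -/
lemma Siblings.unique {v w v' w' : V} (h : N.Siblings v w) (h' : N.Siblings v' w') {x y : N.Point}
    (hv : 0 < N.coord v x) (hw : 0 < N.coord w y) (hv' : 0 < N.coord v' x)
    (hw' : 0 < N.coord w' y) : v = v' ∧ w = w' := by
  have key : ∀ {v w v' w' : V}, N.Siblings v w → N.Siblings v' w' → 0 < N.coord w y →
      0 < N.coord w' y → N.Anc v v' → v = v' := by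
    intro v w v' w' h h' hw hw' ha
    by_contra hne
    have h1 := ((anc_iff h'.1).1 ha).resolve_left hne
    rw [h'.2.2.2] at h1
    have h2 : N.Anc v w' := (anc_iff h'.2.1).2 (Or.inr h1)
    have h3 : 0 < N.coord v y := by
      by_cases he : v = w'
      · rwa [he]
      · rw [coord_eq_arcLen hw' h2 he]
        exact arcLen_pos h.1
    exact hw.ne' (h.coord_eq_zero h3)
  have hvv : v = v' := by
    rcases anc_or_anc_of_coord_pos hv hv' with ha | ha
    · exact key h h' hw hw' ha
    · exact (key h' h hw' hw ha).symm
  refine ⟨hvv, ?_⟩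
  by_contra hne
  have hs : N.Siblings w w' := ⟨h.2.1, h'.2.1, hne, by rw [← h.2.2.2, hvv, h'.2.2.2]⟩
  exact hw'.ne' (hs.coord_eq_zero hw)

/-- A point strictly above a node `u` is on the branch of one of the children of `u`. -/
lemma exists_child_coord_pos {u : V} {x : N.Point} (h : N.Below (N.node u) x) (hne : x ≠ N.node u) :
    ∃ w, w ≠ N.root ∧ N.par w = u ∧ 0 < N.coord w x := by
  rcases point_cases x with rfl | ⟨v, r, hv, h0, h1, rfl⟩
  · exact absurd (Below.antisymm (root_below _) h) hne
  · have ha : u = N.root ∨ N.Anc u v := by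
      by_cases hu : u = N.root
      · exact Or.inl hu
      · refine Or.inr (anc_of_coord_arc_pos hv (r := r) ?_)
        rw [(node_below_iff hu).1 h]
        exact arcLen_pos hu
    by_cases hvu : v = u
    · subst hvu
      rw [node_below_iff hv, coord_arc_self h0.le h1] at h
      exact absurd (by rw [h, node_eq_arc]) hne
    · obtain ⟨w, hw, hwu, hwv⟩ := exists_child_anc ha hvu
      exact ⟨w, hw, hwu, coord_arc_pos h0 hwv h1⟩

lemma node_par_below {w : V} {x : N.Point} (h : 0 < N.coord w x) :
    N.Below (N.node (N.par w)) x := by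
  have hw := ne_root_of_coord_pos h
  by_cases hp : N.par w = N.root
  · rw [hp]
    exact root_below x
  · exact (node_below_iff hp).2
      (coord_eq_arcLen h ((anc_iff hw).2 (Or.inr (anc_self hp))) (par_ne hw))

end Points

/-! ### The length measure -/

section Length

variable {V : Type*} [Fintype V] [DecidableEq V] {N : TreeNetwork V}

/-- The branch of the tree that consists of the points above the parent of `v` in the direction of
`v`, without the parent of `v` itself. -/
def branch (N : TreeNetwork V) (v : V) : Set N.Point := {x | 0 < N.coord v x}

lemma isOpen_branch (v : V) : IsOpen (N.branch v) :=
  isOpen_lt continuous_const (continuous_coord v)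

lemma measurableSet_branch (v : V) : MeasurableSet (N.branch v) := (isOpen_branch v).measurableSet

lemma isClosed_below : IsClosed {p : N.Point × N.Point | N.Below p.1 p.2} := by
  simp only [below_iff, ofPred_forall]
  exact isClosed_iInter fun v => isClosed_le (by fun_prop) (by fun_prop)

lemma measurableSet_below_swap : MeasurableSet {p : N.Point × N.Point | N.Below p.2 p.1} :=
  (isClosed_below.preimage continuous_swap).measurableSet

lemma isClosed_setOf_below (x : N.Point) : IsClosed {y | N.Below y x} :=
  isClosed_below.preimage (f := fun y => (y, x)) (by fun_prop)

lemma isClosed_subtreeAt (x : N.Point) : IsClosed (N.subtreeAt x) :=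
  isClosed_below.preimage (f := fun y => (x, y)) (by fun_prop)

lemma measurableSet_subtreeAt (x : N.Point) : MeasurableSet (N.subtreeAt x) :=
  (isClosed_subtreeAt x).measurableSet

instance nullSingletonClass_lengthMeasure : NullSingletonClass N.lengthMeasure := by
  unfold lengthMeasure
  exact Measure.nullSingletonClass_hausdorff _ one_pos

lemma injOn_arc (v : V) : InjOn (N.arc v) (Ioc 0 (N.arcLen v)) := by
  intro r hr s hs h
  have := congrArg (N.coord v) h
  rwa [coord_arc_self hr.1.le hr.2, coord_arc_self hs.1.le hs.2] at this

/-- On an arc the Hausdorff measure is the Lebesgue measure. -/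
lemma lengthMeasure_image_arc {v : V} {s : Set ℝ} (hs : s ⊆ Ioc 0 (N.arcLen v)) :
    N.lengthMeasure (N.arc v '' s) = volume s := by
  rw [← hausdorffMeasure_real, lengthMeasure]
  refine le_antisymm ?_ ?_
  · have h := (lipschitzWith_arc (N := N) v).hausdorffMeasure_image_le (d := 1) zero_le_one s
    rwa [ENNReal.coe_one, ENNReal.one_rpow, one_mul] at h
  · have h := (lipschitzWith_coord (N := N) v).hausdorffMeasure_image_le (d := 1) zero_le_one
      (N.arc v '' s)
    have hid : (fun r => N.coord v (N.arc v r)) '' s = s :=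
      (image_congr fun r hr => coord_arc_self (hs hr).1.le (hs hr).2).trans (image_id' s)
    rwa [image_image, hid, ENNReal.coe_one, ENNReal.one_rpow, one_mul] at h

lemma disjoint_image_arc {v w : V} (hne : v ≠ w) :
    Disjoint (N.arc v '' Ioc 0 (N.arcLen v)) (N.arc w '' Ioc 0 (N.arcLen w)) := by
  rw [Set.disjoint_left]
  rintro _ ⟨r, hr, rfl⟩ ⟨s, hs, h⟩
  have pos : ∀ {v : V} {r : ℝ}, r ∈ Ioc 0 (N.arcLen v) → v ≠ N.root := by
    rintro v r hr rfl
    rw [arcLen_root] at hr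
    exact absurd hr.1 hr.2.not_gt
  have hv : 0 < N.coord v (N.arc w s) := by
    rw [h, coord_arc_self hr.1.le hr.2]
    exact hr.1
  have hw : 0 < N.coord w (N.arc v r) := by
    rw [← h, coord_arc_self hs.1.le hs.2]
    exact hs.1
  exact hne ((anc_of_coord_arc_pos (pos hs) hv).antisymm (anc_of_coord_arc_pos (pos hr) hw))

/-- The length measure is the sum of the Lebesgue measures of the arcs. -/
lemma lengthMeasure_apply {s : Set N.Point} (hs : MeasurableSet s) :
    N.lengthMeasure s = ∑ v, volume (Ioc 0 (N.arcLen v) ∩ N.arc v ⁻¹' s) := by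
  have hA : ∀ v, N.lengthMeasure (s ∩ N.arc v '' Ioc 0 (N.arcLen v)) =
      volume (Ioc 0 (N.arcLen v) ∩ N.arc v ⁻¹' s) := by
    intro v
    rw [inter_comm, ← image_inter_preimage, lengthMeasure_image_arc inter_subset_left]
  simp only [← hA]
  rw [← measure_biUnion_finset]
  · refine le_antisymm ?_ (measure_mono (iUnion₂_subset fun v _ => inter_subset_left))
    have hsub : s ⊆ {N.node N.root} ∪ ⋃ v ∈ Finset.univ, s ∩ N.arc v '' Ioc 0 (N.arcLen v) := by
      intro x hx
      rcases point_cases x with h | ⟨v, r, -, h0, h1, h⟩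
      · exact Or.inl h
      · exact Or.inr (mem_iUnion₂.2 ⟨v, Finset.mem_univ v, hx, r, ⟨h0, h1⟩, h.symm⟩)
    refine (measure_mono hsub).trans ((measure_union_le _ _).trans ?_)
    rw [measure_singleton, zero_add]
  · intro v _ w _ hne
    exact (disjoint_image_arc hne).mono inter_subset_right inter_subset_right
  · intro v _
    exact hs.inter (measurableSet_Ioc.image_of_continuousOn_injOn
      (lipschitzWith_arc v).continuous.continuousOn (injOn_arc v))

lemma lengthMeasure_univ : N.lengthMeasure univ = ENNReal.ofReal (∑ v, N.arcLen v) := by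
  rw [lengthMeasure_apply MeasurableSet.univ, ENNReal.ofReal_sum_of_nonneg]
  · simp
  · exact fun v _ => N.arcLen_nonneg v

instance isFiniteMeasure_lengthMeasure : IsFiniteMeasure N.lengthMeasure :=
  ⟨by rw [lengthMeasure_univ]; exact ENNReal.ofReal_lt_top⟩

/-- The length of the path from the root to `x`. -/
lemma lengthMeasure_setOf_below (x : N.Point) :
    N.lengthMeasure {y | N.Below y x} = ENNReal.ofReal (∑ v, N.coord v x) := by
  rw [lengthMeasure_apply (isClosed_setOf_below x).measurableSet, ENNReal.ofReal_sum_of_nonneg]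
  · refine Finset.sum_congr rfl fun v _ => ?_
    have : Ioc 0 (N.arcLen v) ∩ N.arc v ⁻¹' {y | N.Below y x} = Ioc 0 (N.coord v x) := by
      ext r
      constructor
      · rintro ⟨hr, h⟩
        exact ⟨hr.1, (arc_below_iff hr.1 hr.2).1 h⟩
      · intro hr
        have hr' : r ≤ N.arcLen v := hr.2.trans (coord_le v x)
        exact ⟨⟨hr.1, hr'⟩, (arc_below_iff hr.1 hr').2 hr.2⟩
    rw [this, Real.volume_Ioc, sub_zero]
  · exact fun v _ => coord_nonneg v x

lemma lengthMeasure_subtreeAt_arc_pos {v : V} {r : ℝ} (h0 : 0 < r) (h1 : r < N.arcLen v) :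
    0 < N.lengthMeasure (N.subtreeAt (N.arc v r)) := by
  rw [lengthMeasure_apply (measurableSet_subtreeAt _)]
  refine lt_of_lt_of_le ?_ (Finset.single_le_sum (fun _ _ => zero_le) (Finset.mem_univ v))
  refine lt_of_lt_of_le ?_ (measure_mono (s := Ioc r (N.arcLen v)) ?_)
  · simpa using h1
  · intro s hs
    refine ⟨⟨h0.trans hs.1, hs.2⟩, (arc_below_iff h0 h1.le).2 ?_⟩
    rw [coord_arc_self (h0.trans hs.1).le hs.2]
    exact hs.1.le

lemma lengthMeasure_branch_pos {v : V} (hv : v ≠ N.root) : 0 < N.lengthMeasure (N.branch v) := by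
  have h := arcLen_pos hv
  refine (lengthMeasure_subtreeAt_arc_pos (half_pos h) (half_lt_self h)).trans_le
    (measure_mono fun x hx => ?_)
  exact (half_pos h).trans_le ((arc_below_iff (half_pos h) (half_lt_self h).le).1 hx)

variable (N) in
/-- The children of the node `u`. -/
def children (u : V) : Finset V := {w | w ≠ N.root ∧ N.par w = u}

lemma mem_children {u w : V} : w ∈ N.children u ↔ w ≠ N.root ∧ N.par w = u := by
  simp [children]

lemma branch_subset_subtreeAt {u w : V} (h : w ∈ N.children u) :
    N.branch w ⊆ N.subtreeAt (N.node u) := by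
  rw [← (mem_children.1 h).2]
  exact fun x hx => node_par_below hx

lemma sum_measure_branch_le (μ : Measure N.Point) {U : Set N.Point} (hU : MeasurableSet U) (u : V) :
    ∑ w ∈ N.children u, μ (U ∩ N.branch w) ≤ μ (U ∩ N.subtreeAt (N.node u)) := by
  rw [← measure_biUnion_finset]
  · exact measure_mono (iUnion₂_subset fun w hw =>
      inter_subset_inter_right _ (branch_subset_subtreeAt hw))
  · intro v hv w hw hne
    rw [Finset.mem_coe, mem_children] at hv hw
    refine Set.disjoint_left.2 fun x hx hx' => ?_
    have hs : N.Siblings v w := ⟨hv.1, hw.1, hne, hv.2.trans hw.2.symm⟩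
    exact (hx'.2 : 0 < N.coord w x).ne' (hs.coord_eq_zero hx.2)
  · exact fun w _ => hU.inter (measurableSet_branch w)

lemma lengthMeasure_le_sum_branch (U : Set N.Point) (u : V) :
    N.lengthMeasure (U ∩ N.subtreeAt (N.node u)) ≤
      ∑ w ∈ N.children u, N.lengthMeasure (U ∩ N.branch w) := by
  have hsub : U ∩ N.subtreeAt (N.node u) ⊆
      {N.node u} ∪ ⋃ w ∈ N.children u, U ∩ N.branch w := by
    rintro x ⟨hx, hux⟩
    by_cases h : x = N.node u
    · exact Or.inl h
    · obtain ⟨w, hw, hwu, hwx⟩ := exists_child_coord_pos hux h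
      exact Or.inr (mem_iUnion₂.2 ⟨w, mem_children.2 ⟨hw, hwu⟩, hx, hwx⟩)
  refine (measure_mono hsub).trans ((measure_union_le _ _).trans ?_)
  rw [measure_singleton, zero_add]
  exact measure_biUnion_finset_le _ _

/-! ### Monotone hiding distributions -/

/-- If all the subtrees in a branch have density at least `c`, then so does every upper set in the
branch. The part of an upper set in a branch is exhausted by an increasing sequence of subtrees if
the upper set contains the first node of the branch; otherwise it lies above that node and splits
into the parts in the branches there. -/
lemma mul_lengthMeasure_le_of_isUpper {h : Measure N.Point} {c : ℝ≥0∞} {U : Set N.Point}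
    (hU : MeasurableSet U) (hup : ∀ x ∈ U, ∀ y, N.Below x y → y ∈ U) (w : V) (hw : w ≠ N.root)
    (hc : ∀ z ∈ N.branch w, c * N.lengthMeasure (N.subtreeAt z) ≤ h (N.subtreeAt z)) :
    c * N.lengthMeasure (U ∩ N.branch w) ≤ h (U ∩ N.branch w) := by
  have wf : WellFounded fun a b : V => N.depth b < N.depth a :=
    haveI : IsTrans V fun a b : V => N.depth b < N.depth a := ⟨fun _ _ _ h1 h2 => h2.trans h1⟩
    haveI : Std.Irrefl fun a b : V => N.depth b < N.depth a := ⟨fun _ => lt_irrefl _⟩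
    Finite.wellFounded_of_trans_of_irrefl _
  induction w using wf.induction with
  | _ w ih =>
  have hl := arcLen_pos hw
  by_cases hwU : N.node w ∈ U
  · -- the positions on the arc at which the upper set has points
    set R : Set ℝ := {r | 0 < r ∧ r ≤ N.arcLen w ∧ N.arc w r ∈ U} with hR
    have hRne : R.Nonempty := ⟨N.arcLen w, hl, le_rfl, by rwa [← node_eq_arc]⟩
    have hRb : BddBelow R := ⟨0, fun r hr => hr.1.le⟩
    have hQ : ∀ r ∈ R, N.subtreeAt (N.arc w r) ⊆ U ∩ N.branch w := fun r hr x hx =>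
      ⟨hup _ hr.2.2 x hx, hr.1.trans_le ((arc_below_iff hr.1 hr.2.1).1 hx)⟩
    have hmem : ∀ x ∈ U ∩ N.branch w, N.coord w x ∈ R := by
      rintro x ⟨hx, hxw : 0 < N.coord w x⟩
      refine ⟨hxw, coord_le w x, ?_⟩
      rcases (coord_le w x).eq_or_lt with heq | hlt
      · rwa [heq, ← node_eq_arc]
      · rwa [← eq_arc_of_coord hxw hlt]
    have hcQ : ∀ r ∈ R, c * N.lengthMeasure (N.subtreeAt (N.arc w r)) ≤ h (U ∩ N.branch w) :=
      fun r hr => (hc _ (by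
        change 0 < N.coord w _
        rw [coord_arc_self hr.1.le hr.2.1]
        exact hr.1)).trans (measure_mono (hQ r hr))
    by_cases ha : sInf R ∈ R
    · refine (mul_le_mul_right (measure_mono fun x hx => ?_) c).trans (hcQ _ ha)
      exact (arc_below_iff ha.1 ha.2.1).2 (csInf_le hRb (hmem x hx))
    · obtain ⟨r, hr_anti, hr_lim, hr_mem⟩ := exists_seq_tendsto_sInf hRne hRb
      have hun : U ∩ N.branch w = ⋃ n, N.subtreeAt (N.arc w (r n)) := by
        refine Subset.antisymm (fun x hx => ?_) (iUnion_subset fun n => hQ _ (hr_mem n))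
        have hx' := hmem x hx
        have hlt : sInf R < N.coord w x :=
          lt_of_le_of_ne (csInf_le hRb hx') fun he => ha (he ▸ hx')
        obtain ⟨n, hn⟩ := (hr_lim.eventually_lt_const hlt).exists
        exact mem_iUnion.2 ⟨n, (arc_below_iff (hr_mem n).1 (hr_mem n).2.1).2 hn.le⟩
      have hmo : Monotone fun n => N.subtreeAt (N.arc w (r n)) := by
        intro m n hmn x hx
        have h1 := (arc_below_iff (hr_mem m).1 (hr_mem m).2.1).1 hx
        exact (arc_below_iff (hr_mem n).1 (hr_mem n).2.1).2 ((hr_anti hmn).trans h1)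
      have hlen : N.lengthMeasure (U ∩ N.branch w) =
          ⨆ n, N.lengthMeasure (N.subtreeAt (N.arc w (r n))) := by
        rw [hun]
        exact hmo.measure_iUnion
      rw [hlen, ENNReal.mul_iSup]
      exact iSup_le fun n => hcQ _ (hr_mem n)
  · have heq : U ∩ N.branch w = U ∩ N.subtreeAt (N.node w) := by
      refine Subset.antisymm ?_ ?_
      · rintro x ⟨hx, hxw : 0 < N.coord w x⟩
        refine ⟨hx, (node_below_iff hw).2 ?_⟩
        by_contra hne
        rw [eq_arc_of_coord hxw ((coord_le w x).lt_of_ne hne)] at hx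
        exact hwU (hup _ hx _ (arc_below_node w _))
      · rintro x ⟨hx, hxw⟩
        refine ⟨hx, ?_⟩
        change 0 < N.coord w x
        rw [(node_below_iff hw).1 hxw]
        exact hl
    rw [heq]
    calc c * N.lengthMeasure (U ∩ N.subtreeAt (N.node w))
        ≤ c * ∑ v ∈ N.children w, N.lengthMeasure (U ∩ N.branch v) :=
          mul_le_mul_right (lengthMeasure_le_sum_branch U w) c
      _ = ∑ v ∈ N.children w, c * N.lengthMeasure (U ∩ N.branch v) := Finset.mul_sum _ _ _
      _ ≤ ∑ v ∈ N.children w, h (U ∩ N.branch v) := by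
          refine Finset.sum_le_sum fun v hv => ?_
          have hv' := mem_children.1 hv
          refine ih v ?_ hv'.1 fun z hz => hc z ?_
          · rw [depth_par hv'.1, hv'.2]
            exact Nat.lt_succ_self _
          · change 0 < N.coord w z
            rw [(node_below_iff hw).1 (branch_subset_subtreeAt hv hz)]
            exact hl
      _ ≤ h (U ∩ N.subtreeAt (N.node w)) := sum_measure_branch_le h hU w

section Monotone

variable {h : Measure N.Point}

lemma IsMonotone.mul_le (hmono : IsMonotone h) {x y : N.Point} (hxy : N.Below x y) :
    density h (N.subtreeAt x) * N.lengthMeasure (N.subtreeAt y) ≤ h (N.subtreeAt y) := by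
  rcases eq_or_ne (N.lengthMeasure (N.subtreeAt y)) 0 with h0 | h0
  · simp [h0]
  · refine (mul_le_mul_left (hmono x y hxy (pos_iff_ne_zero.2 h0)) _).trans_eq ?_
    exact ENNReal.div_mul_cancel h0 (measure_ne_top _ _)

/-- An upper set in a branch at a node has at least the density of the subtree at that node. -/
lemma IsMonotone.density_mul_le (hmono : IsMonotone h) {U : Set N.Point} (hU : MeasurableSet U)
    (hup : ∀ x ∈ U, ∀ y, N.Below x y → y ∈ U) {w : V} (hw : w ≠ N.root) :
    density h (N.subtreeAt (N.node (N.par w))) * N.lengthMeasure (U ∩ N.branch w) ≤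
      h (U ∩ N.branch w) :=
  mul_lengthMeasure_le_of_isUpper hU hup w hw fun _ hz => hmono.mul_le (node_par_below hz)

/-- A branch at a node has the same density as the subtree at that node: none can have a smaller
density, and the subtree is the union of the branches and a point. -/
lemma IsMonotone.measure_branch [IsFiniteMeasure h] (hmono : IsMonotone h) {w : V}
    (hw : w ≠ N.root) :
    h (N.branch w) =
      density h (N.subtreeAt (N.node (N.par w))) * N.lengthMeasure (N.branch w) := by
  set c := density h (N.subtreeAt (N.node (N.par w))) with hc
  have hwc : w ∈ N.children (N.par w) := mem_children.2 ⟨hw, rfl⟩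
  have hle : ∀ v ∈ N.children (N.par w), c * N.lengthMeasure (N.branch v) ≤ h (N.branch v) := by
    intro v hv
    have hv' := mem_children.1 hv
    have := hmono.density_mul_le MeasurableSet.univ (fun _ _ _ _ => mem_univ _) hv'.1
    rwa [univ_inter, hv'.2, ← hc] at this
  have hpos : 0 < N.lengthMeasure (N.subtreeAt (N.node (N.par w))) :=
    (lengthMeasure_branch_pos hw).trans_le (measure_mono (branch_subset_subtreeAt hwc))
  have hsum : ∑ v ∈ N.children (N.par w), h (N.branch v) ≤
      ∑ v ∈ N.children (N.par w), c * N.lengthMeasure (N.branch v) := by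
    have h1 := sum_measure_branch_le h MeasurableSet.univ (N.par w)
    have h2 := lengthMeasure_le_sum_branch (N := N) univ (N.par w)
    simp only [univ_inter] at h1 h2
    rw [← Finset.mul_sum]
    refine h1.trans (le_trans (le_of_eq ?_) (mul_le_mul_right h2 c))
    exact (ENNReal.div_mul_cancel hpos.ne' (measure_ne_top _ _)).symm
  refine le_antisymm ?_ (hle w hwc)
  rw [← Finset.add_sum_erase _ _ hwc, ← Finset.add_sum_erase _ _ hwc] at hsum
  have hrest : ∑ v ∈ (N.children (N.par w)).erase w, c * N.lengthMeasure (N.branch v) ≤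
      ∑ v ∈ (N.children (N.par w)).erase w, h (N.branch v) :=
    Finset.sum_le_sum fun v hv => hle v (Finset.mem_of_mem_erase hv)
  have hfin : ∑ v ∈ (N.children (N.par w)).erase w, h (N.branch v) ≠ ∞ :=
    ENNReal.sum_ne_top.2 fun v _ => measure_ne_top _ _
  exact (ENNReal.add_le_add_iff_right hfin).1 (hsum.trans (add_le_add_right hrest _))

/-- The pairs `(x, y)` with `x` on the branch of `v`, `y` on the branch of `w`, and `y` reached no
later than `x`. -/
def orderedPairs (T : N.Point → ℝ≥0∞) (v w : V) : Set (N.Point × N.Point) :=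
  {p | p.1 ∈ N.branch v ∧ p.2 ∈ N.branch w ∧ T p.2 ≤ T p.1}

lemma measurableSet_orderedPairs {T : N.Point → ℝ≥0∞} (hT : Measurable T) (v w : V) :
    MeasurableSet (orderedPairs T v w) :=
  ((measurableSet_branch v).preimage measurable_fst).inter
    (((measurableSet_branch w).preimage measurable_snd).inter
      (measurableSet_le (hT.comp measurable_snd) (hT.comp measurable_fst)))

/-- For points `x` distributed according to `h` and `y` according to length on two branches at a
node, replacing `h` by length makes `x` earlier. -/
lemma IsMonotone.density_mul_orderedPairs_le [IsFiniteMeasure h] (hmono : IsMonotone h)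
    {T : N.Point → ℝ≥0∞} (hT : Measurable T) (hTm : ∀ x y, N.Below x y → T x ≤ T y) {v : V}
    (hv : v ≠ N.root) (w : V) :
    density h (N.subtreeAt (N.node (N.par v))) *
        (N.lengthMeasure.prod N.lengthMeasure) (orderedPairs T v w) ≤
      (h.prod N.lengthMeasure) (orderedPairs T v w) := by
  have hm := measurableSet_orderedPairs (N := N) hT v w
  rw [Measure.prod_apply_symm hm, Measure.prod_apply_symm hm,
    ← lintegral_const_mul _ (measurable_measure_prodMk_right hm)]
  refine lintegral_mono fun y => ?_
  by_cases hy : y ∈ N.branch w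
  · have hset : (fun x => (x, y)) ⁻¹' orderedPairs T v w = {x | T y ≤ T x} ∩ N.branch v := by
      ext x
      simp only [orderedPairs, mem_preimage, mem_ofPred_eq, mem_inter_iff]
      tauto
    rw [hset]
    exact hmono.density_mul_le (measurableSet_le measurable_const hT)
      (fun x hx z hxz => le_trans hx (hTm x z hxz)) hv
  · have hset : (fun x => (x, y)) ⁻¹' orderedPairs T v w = ∅ := by
      ext x
      simp [orderedPairs, hy]
    simp [hset]

/-- Of the pairs of points of two branches at a node, at least half are in the right order. -/
lemma IsMonotone.siblings_le [IsFiniteMeasure h] (hmono : IsMonotone h)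
    {T : N.Point → ℝ≥0∞} (hT : Measurable T) (hTm : ∀ x y, N.Below x y → T x ≤ T y) {v w : V}
    (hs : N.Siblings v w) :
    h (N.branch v) * N.lengthMeasure (N.branch w) +
        h (N.branch w) * N.lengthMeasure (N.branch v) ≤
      2 * ((h.prod N.lengthMeasure) (orderedPairs T v w) +
        (h.prod N.lengthMeasure) (orderedPairs T w v)) := by
  have h1 := hmono.density_mul_orderedPairs_le hT hTm hs.1 w
  have h2 := hmono.density_mul_orderedPairs_le hT hTm hs.2.1 v
  rw [hmono.measure_branch hs.1, hmono.measure_branch hs.2.1]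
  rw [← hs.2.2.2] at h2 ⊢
  set c := density h (N.subtreeAt (N.node (N.par v)))
  have hsw : (N.lengthMeasure.prod N.lengthMeasure) (Prod.swap ⁻¹' orderedPairs T w v) =
      (N.lengthMeasure.prod N.lengthMeasure) (orderedPairs T w v) :=
    (Measure.measurePreserving_swap).measure_preimage
      (measurableSet_orderedPairs hT w v).nullMeasurableSet
  have hcov : N.branch v ×ˢ N.branch w ⊆
      orderedPairs T v w ∪ Prod.swap ⁻¹' orderedPairs T w v := by
    rintro ⟨x, y⟩ ⟨hx, hy⟩
    rcases le_total (T y) (T x) with hle | hle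
    · exact Or.inl ⟨hx, hy, hle⟩
    · exact Or.inr ⟨hy, hx, hle⟩
  have h3 : N.lengthMeasure (N.branch v) * N.lengthMeasure (N.branch w) ≤
      (N.lengthMeasure.prod N.lengthMeasure) (orderedPairs T v w) +
        (N.lengthMeasure.prod N.lengthMeasure) (orderedPairs T w v) := by
    rw [← Measure.prod_prod, ← hsw]
    exact (measure_mono hcov).trans (measure_union_le _ _)
  calc c * N.lengthMeasure (N.branch v) * N.lengthMeasure (N.branch w) +
        c * N.lengthMeasure (N.branch w) * N.lengthMeasure (N.branch v)
      = 2 * (c * (N.lengthMeasure (N.branch v) * N.lengthMeasure (N.branch w))) := by ring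
    _ ≤ 2 * (c * ((N.lengthMeasure.prod N.lengthMeasure) (orderedPairs T v w) +
        (N.lengthMeasure.prod N.lengthMeasure) (orderedPairs T w v))) := by gcongr
    _ ≤ _ := by
        rw [mul_add]
        gcongr

open Classical in
variable (N) in
/-- The ordered pairs of siblings. -/
def siblingPairs : Finset (V × V) := {p | N.Siblings p.1 p.2}

lemma mem_siblingPairs {p : V × V} : p ∈ N.siblingPairs ↔ N.Siblings p.1 p.2 := by
  simp [siblingPairs]

lemma sum_siblingPairs_swap (f : V → V → ℝ≥0∞) :
    ∑ p ∈ N.siblingPairs, f p.2 p.1 = ∑ p ∈ N.siblingPairs, f p.1 p.2 :=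
  Finset.sum_nbij' Prod.swap Prod.swap
    (fun _ hp => mem_siblingPairs.2 (mem_siblingPairs.1 hp).symm)
    (fun _ hp => mem_siblingPairs.2 (mem_siblingPairs.1 hp).symm)
    (fun _ _ => rfl) (fun _ _ => rfl) (fun _ _ => rfl)

/-- The minimal expected search time against the monotone hiding distribution `h`: the expected
length of the path to the hider, plus the sum over all pairs of branches at a node of the
probability that the hider is on the first, times the length of the second. -/
def searchValue (h : Measure N.Point) : ℝ≥0∞ :=
  ∫⁻ x, N.lengthMeasure {y | N.Below y x} ∂h +
    ∑ p ∈ N.siblingPairs, h (N.branch p.1) * N.lengthMeasure (N.branch p.2)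

lemma lintegral_below [SFinite h] : ∫⁻ x, N.lengthMeasure {y | N.Below y x} ∂h =
    (h.prod N.lengthMeasure) {p | N.Below p.2 p.1} := by
  rw [Measure.prod_apply measurableSet_below_swap]
  rfl

lemma IsMonotone.sum_siblings_le [IsFiniteMeasure h] (hmono : IsMonotone h)
    {T : N.Point → ℝ≥0∞} (hT : Measurable T) (hTm : ∀ x y, N.Below x y → T x ≤ T y) :
    ∑ p ∈ N.siblingPairs, h (N.branch p.1) * N.lengthMeasure (N.branch p.2) ≤
      2 * ∑ p ∈ N.siblingPairs, (h.prod N.lengthMeasure) (orderedPairs T p.1 p.2) := by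
  have h1 := Finset.sum_le_sum fun p (hp : p ∈ N.siblingPairs) =>
    hmono.siblings_le hT hTm (mem_siblingPairs.1 hp)
  rw [Finset.sum_add_distrib,
    sum_siblingPairs_swap (fun v w => h (N.branch v) * N.lengthMeasure (N.branch w)),
    ← Finset.mul_sum, Finset.sum_add_distrib,
    sum_siblingPairs_swap (fun v w => (h.prod N.lengthMeasure) (orderedPairs T v w)),
    ← two_mul, ← two_mul] at h1
  exact (ENNReal.mul_le_mul_iff_right two_ne_zero ENNReal.ofNat_ne_top).1 h1

/-- A pair of points is comparable, or on the branches of at most one pair of siblings. -/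
lemma below_add_sum_orderedPairs_le (μ : Measure (N.Point × N.Point))
    {T : N.Point → ℝ≥0∞} (hT : Measurable T) (hTm : ∀ x y, N.Below x y → T x ≤ T y) :
    μ {p | N.Below p.2 p.1} + ∑ p ∈ N.siblingPairs, μ (orderedPairs T p.1 p.2) ≤
      μ {p | T p.2 ≤ T p.1} := by
  have hm : ∀ p ∈ N.siblingPairs, MeasurableSet (orderedPairs T p.1 p.2) :=
    fun p _ => measurableSet_orderedPairs hT p.1 p.2
  have hpair : (N.siblingPairs : Set (V × V)).PairwiseDisjoint
      (fun p => orderedPairs T p.1 p.2) := by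
    intro p hp q hq hne
    refine Set.disjoint_left.2 fun z hz hz' => hne ?_
    have := (mem_siblingPairs.1 hp).unique (mem_siblingPairs.1 hq) hz.1 hz.2.1 hz'.1 hz'.2.1
    exact Prod.ext this.1 this.2
  have hdisj : Disjoint {p : N.Point × N.Point | N.Below p.2 p.1}
      (⋃ p ∈ N.siblingPairs, orderedPairs T p.1 p.2) := by
    refine Set.disjoint_left.2 fun q hq hq' => ?_
    obtain ⟨p, hp, h1, h2, -⟩ := mem_iUnion₂.1 hq'
    have h0 := (mem_siblingPairs.1 hp).coord_eq_zero h1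
    have h3 := below_iff.1 hq p.2
    rw [h0] at h3
    exact absurd h2 h3.not_gt
  rw [← measure_biUnion_finset hpair hm,
    ← measure_union hdisj (Finset.measurableSet_biUnion _ hm)]
  refine measure_mono (union_subset (fun p hp => hTm _ _ hp) ?_)
  exact iUnion₂_subset fun p _ q hq => hq.2.2

/-- The expected length of the part of the network that is explored by the time when the hider is
found is at least `(∫ d(O, x) dh(x) + searchValue h) / 2`. -/
lemma IsMonotone.searchValue_le [IsFiniteMeasure h] (hmono : IsMonotone h)
    {T : N.Point → ℝ≥0∞} (hT : Measurable T) (hTm : ∀ x y, N.Below x y → T x ≤ T y) :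
    ∫⁻ x, N.lengthMeasure {y | N.Below y x} ∂h + searchValue h ≤
      2 * ∫⁻ x, N.lengthMeasure {y | T y ≤ T x} ∂h := by
  have hmT : MeasurableSet {p : N.Point × N.Point | T p.2 ≤ T p.1} :=
    measurableSet_le (hT.comp measurable_snd) (hT.comp measurable_fst)
  have hint : ∫⁻ x, N.lengthMeasure {y | T y ≤ T x} ∂h =
      (h.prod N.lengthMeasure) {p | T p.2 ≤ T p.1} := by
    rw [Measure.prod_apply hmT]
    rfl
  rw [searchValue, lintegral_below, hint, ← add_assoc, ← two_mul]
  refine (add_le_add_right (hmono.sum_siblings_le hT hTm) _).trans ?_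
  rw [← mul_add]
  exact mul_le_mul_right (below_add_sum_orderedPairs_le _ hT hTm) 2

open Classical in
/-- The network is covered by the path to `x`, the subtree at `x`, and the branches that leave the
path to `x`. -/
lemma lengthMeasure_univ_le (x : N.Point) : N.lengthMeasure univ ≤
    N.lengthMeasure (N.subtreeAt x) + (N.lengthMeasure {y | N.Below y x} +
      ∑ p ∈ N.siblingPairs,
        (N.branch p.1).indicator (fun _ => N.lengthMeasure (N.branch p.2)) x) := by
  have hcov : (univ : Set N.Point) ⊆ N.subtreeAt x ∪ ({y | N.Below y x} ∪
      ⋃ p ∈ N.siblingPairs.filter (fun p => x ∈ N.branch p.1), N.branch p.2) := by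
    intro y _
    rcases below_trichotomy x y with h | h | ⟨v, w, hs, hv, hw⟩
    · exact Or.inl h
    · exact Or.inr (Or.inl h)
    · exact Or.inr (Or.inr (mem_iUnion₂.2 ⟨(v, w),
        Finset.mem_filter.2 ⟨mem_siblingPairs.2 hs, hv⟩, hw⟩))
  refine (measure_mono hcov).trans ((measure_union_le _ _).trans ?_)
  gcongr
  refine (measure_union_le _ _).trans ?_
  gcongr
  refine (measure_biUnion_finset_le _ _).trans_eq ?_
  rw [Finset.sum_filter]
  rfl

lemma lintegral_below_add_siblings :
    ∫⁻ x, (N.lengthMeasure {y | N.Below y x} + ∑ p ∈ N.siblingPairs,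
      (N.branch p.1).indicator (fun _ => N.lengthMeasure (N.branch p.2)) x) ∂h = searchValue h := by
  rw [lintegral_add_right, lintegral_finsetSum]
  · simp [searchValue, lintegral_indicator_const (measurableSet_branch _), mul_comm]
  · exact fun p _ => measurable_const.indicator (measurableSet_branch _)
  · exact Finset.measurable_sum _ fun p _ => measurable_const.indicator (measurableSet_branch _)

lemma searchValue_ne_top [IsFiniteMeasure h] : searchValue h ≠ ∞ := by
  refine ENNReal.add_ne_top.2 ⟨?_, ENNReal.sum_ne_top.2 fun p _ =>
    ENNReal.mul_ne_top (measure_ne_top _ _) (measure_ne_top _ _)⟩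
  rw [lintegral_below]
  exact measure_ne_top _ _

/-- All the subtrees of positive length have positive measure. -/
lemma IsMonotone.measure_subtreeAt_pos [IsProbabilityMeasure h] (hmono : IsMonotone h)
    {x : N.Point} (hx : 0 < N.lengthMeasure (N.subtreeAt x)) : 0 < h (N.subtreeAt x) := by
  have huniv : N.subtreeAt (N.node N.root) = univ := eq_univ_of_forall fun y => root_below y
  have h1 := hmono.mul_le (root_below x)
  refine lt_of_lt_of_le (ENNReal.mul_pos ?_ hx.ne') h1
  rw [density, huniv, measure_univ]
  exact ENNReal.div_ne_zero.2 ⟨one_ne_zero, measure_ne_top _ _⟩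

end Monotone

end Length

/-! ### Searches -/

section Searches

variable {V : Type*} [Fintype V] [DecidableEq V] {N : TreeNetwork V}

/-- A path of speed at most one in `ℓ¹` needs time to move a coordinate `v` to an intermediate value
and on to its final value, and it cannot save time by moving several coordinates at once. -/
lemma sum_variation_le {F : ℝ≥0 → V → ℝ} (hF : ∀ a b, a ≤ b → ∑ v, |F b v - F a v| ≤ b - a)
    (s : V → ℝ≥0) (A : Finset V) {a : ℝ≥0} (ha : ∀ v ∈ A, a ≤ s v) {b : ℝ≥0} (hab : a ≤ b)
    (hb : ∀ v ∈ A, s v ≤ b) :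
    ∑ v, (if v ∈ A then |F (s v) v - F a v| + |F b v - F (s v) v| else |F b v - F a v|) ≤
      b - a := by
  induction A using Finset.induction_on_max_value s generalizing b with
  | empty => simpa using hF a b hab
  | insert x A hx hmax ih =>
    -- split the time at the last of the intermediate times
    have h1 := ih (fun v hv => ha v (Finset.mem_insert_of_mem hv))
      (ha x (Finset.mem_insert_self x A)) hmax
    have hxb := hb x (Finset.mem_insert_self x A)
    have h2 := hF (s x) b hxb
    have h3 := add_le_add h1 h2
    rw [← Finset.sum_add_distrib] at h3
    refine (Finset.sum_le_sum fun v _ => ?_).trans (h3.trans_eq (by ring))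
    by_cases hvA : v ∈ A
    · rw [if_pos (Finset.mem_insert_of_mem hvA), if_pos hvA]
      linarith [abs_sub_le (F b v) (F (s x) v) (F (s v) v)]
    · rw [if_neg hvA]
      by_cases hvx : v = x
      · subst hvx
        rw [if_pos (Finset.mem_insert_self v A)]
      · rw [if_neg (by simp [hvx, hvA])]
        linarith [abs_sub_le (F b v) (F (s x) v) (F a v)]

lemma sum_abs_coord_sub_le {S : ℝ≥0 → N.Point} (hS : LipschitzWith 1 S) (a b : ℝ≥0) (hab : a ≤ b) :
    ∑ v, |N.coord v (S b) - N.coord v (S a)| ≤ b - a := by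
  rw [← dist_eq_sum_coord]
  refine (hS.dist_le_mul b a).trans_eq ?_
  rw [NNReal.coe_one, one_mul, NNReal.dist_eq,
    abs_of_nonneg (sub_nonneg.2 (NNReal.coe_le_coe.2 hab))]

variable {S : ℝ≥0 → N.Point}

/-- A continuous path from the root to `x` visits all the points between the root and `x`. -/
lemma exists_visit_of_below (hS : Continuous S) (h0 : S 0 = N.node N.root) {x y : N.Point}
    {t : ℝ≥0} (ht : S t = x) (hyx : N.Below y x) : ∃ s ≤ t, S s = y := by
  rcases point_cases y with rfl | ⟨v, r, hv, hr0, hr1, rfl⟩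
  · exact ⟨0, zero_le, h0⟩
  have hrx : r ≤ N.coord v (S t) := by
    rw [ht]
    exact (arc_below_iff hr0 hr1).1 hyx
  have hf : Continuous fun s => N.coord v (S s) := (continuous_coord v).comp hS
  -- the first time at which the coordinate of the arc reaches the value `r`
  obtain ⟨s, hs⟩ : ∃ s, IsLeast {s | r ≤ N.coord v (S s)} s :=
    ⟨_, (isClosed_le continuous_const hf).isLeast_csInf ⟨t, hrx⟩ (OrderBot.bddBelow _)⟩
  refine ⟨s, hs.2 hrx, ?_⟩
  have hlt : ∀ s' < s, N.coord v (S s') < r := fun s' h => not_le.1 fun h' => (hs.2 h').not_gt h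
  have hs0 : 0 < s := by
    refine pos_iff_ne_zero.2 fun h => ?_
    have := hs.1
    rw [h] at this
    simp only [mem_ofPred_eq, h0, coord_node_root] at this
    exact absurd hr0 this.not_gt
  have : (𝓝[<] s).NeBot := nhdsLT_neBot_of_exists_lt ⟨0, hs0⟩
  have hlim : Tendsto (fun s' => N.coord v (S s')) (𝓝[<] s) (𝓝 (N.coord v (S s))) :=
    (hf.tendsto s).mono_left nhdsWithin_le_nhds
  have hval : N.coord v (S s) = r :=
    le_antisymm (le_of_tendsto hlim (by
      filter_upwards [self_mem_nhdsWithin] with s' hs' using (hlt s' hs').le)) hs.1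
  -- just before this time the search is on the arc
  have hev : ∀ᶠ s' in 𝓝[<] s, S s' = N.arc v (N.coord v (S s')) := by
    filter_upwards [self_mem_nhdsWithin, hlim.eventually (lt_mem_nhds (hval ▸ hr0))] with s' h1 h2
    exact eq_arc_of_coord h2 ((hlt s' h1).trans_le hr1)
  have h1 : Tendsto S (𝓝[<] s) (𝓝 (S s)) := (hS.tendsto s).mono_left nhdsWithin_le_nhds
  have h2 : Tendsto S (𝓝[<] s) (𝓝 (N.arc v r)) :=
    (((lipschitzWith_arc v).continuous.tendsto r).comp (hval ▸ hlim)).congr'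
      (hev.mono fun _ h => h.symm)
  exact tendsto_nhds_unique h1 h2

lemma searchTime_le {x : N.Point} {t : ℝ≥0} (h : S t = x) : searchTime S x ≤ t :=
  iInf₂_le t h

/-- The infimum in the definition of the search time is attained. -/
lemma exists_searchTime_eq (hS : Continuous S) {x : N.Point} (h : searchTime S x ≠ ∞) :
    ∃ t : ℝ≥0, S t = x ∧ searchTime S x = t ∧ ∀ s, S s = x → t ≤ s := by
  have hne : {t | S t = x}.Nonempty := by
    by_contra hemp
    refine h ?_
    rw [searchTime, iInf₂_eq_top]
    exact fun t ht => absurd ⟨t, ht⟩ hemp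
  obtain ⟨t, ht⟩ : ∃ t, IsLeast {t | S t = x} t :=
    ⟨_, (isClosed_eq hS continuous_const).isLeast_csInf hne (OrderBot.bddBelow _)⟩
  refine ⟨t, ht.1, le_antisymm (searchTime_le ht.1) ?_, fun s hs => ht.2 hs⟩
  exact le_iInf₂ fun s hs => ENNReal.coe_le_coe.2 (ht.2 hs)

lemma searchTime_le_coe_iff (hS : Continuous S) {x : N.Point} {t : ℝ≥0} :
    searchTime S x ≤ t ↔ ∃ s ≤ t, S s = x := by
  constructor
  · intro h
    obtain ⟨s, hs, he, -⟩ := exists_searchTime_eq hS (ne_top_of_le_ne_top ENNReal.coe_ne_top h)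
    exact ⟨s, by rwa [he, ENNReal.coe_le_coe] at h, hs⟩
  · rintro ⟨s, hst, hs⟩
    exact (searchTime_le hs).trans (ENNReal.coe_le_coe.2 hst)

lemma isClosed_image_Icc (hS : Continuous S) (t : ℝ≥0) : IsClosed (S '' Icc 0 t) :=
  (isCompact_Icc.image hS).isClosed

lemma measurable_searchTime (hS : Continuous S) : Measurable (searchTime S) := by
  refine measurable_of_Iic fun a => ?_
  by_cases ha : a = ∞
  · simp [ha]
  · lift a to ℝ≥0 using ha
    have : searchTime S ⁻¹' Iic (a : ℝ≥0∞) = S '' Icc 0 a := by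
      ext x
      simp only [mem_preimage, mem_Iic, searchTime_le_coe_iff hS, mem_image, mem_Icc, zero_le,
        true_and]
    rw [this]
    exact (isClosed_image_Icc hS a).measurableSet

lemma searchTime_mono (hS : IsSearch S) (x y : N.Point) (hxy : N.Below x y) :
    searchTime S x ≤ searchTime S y := by
  refine le_iInf₂ fun t ht => ?_
  obtain ⟨s, hst, hs⟩ := exists_visit_of_below hS.2.continuous hS.1 ht hxy
  exact (searchTime_le hs).trans (ENNReal.coe_le_coe.2 hst)

/-- When a search reaches `x`, it has traversed the path from the root to `x` at least once, and the
rest of the explored part of the network at least twice. -/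
lemma two_mul_lengthMeasure_le (hS : IsSearch S) (x : N.Point) :
    2 * N.lengthMeasure {y | searchTime S y ≤ searchTime S x} ≤
      searchTime S x + N.lengthMeasure {y | N.Below y x} := by
  by_cases htop : searchTime S x = ∞
  · simp [htop]
  have hc := hS.2.continuous
  obtain ⟨t, ht, hTx, -⟩ := exists_searchTime_eq hc htop
  -- the times at which the coordinates attain their maxima
  have hmax : ∀ v, ∃ s ≤ t, ∀ s' ≤ t, N.coord v (S s') ≤ N.coord v (S s) := by
    intro v
    obtain ⟨s, hs, hm⟩ := isCompact_Icc.exists_isMaxOn (s := Icc (0 : ℝ≥0) t)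
      ⟨0, left_mem_Icc.2 zero_le⟩ ((continuous_coord (N := N) v).comp hc).continuousOn
    exact ⟨s, hs.2, fun s' hs' => hm ⟨zero_le, hs'⟩⟩
  choose s hs hm using hmax
  have hlen : N.lengthMeasure {y | searchTime S y ≤ searchTime S x} ≤
      ENNReal.ofReal (∑ v, N.coord v (S (s v))) := by
    have hmeas : MeasurableSet {y | searchTime S y ≤ searchTime S x} :=
      measurableSet_le (measurable_searchTime hc) measurable_const
    rw [lengthMeasure_apply hmeas, ENNReal.ofReal_sum_of_nonneg fun v _ => coord_nonneg _ _]
    refine Finset.sum_le_sum fun v _ => ?_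
    refine (measure_mono (t := Ioc 0 (N.coord v (S (s v)))) ?_).trans_eq (by simp)
    rintro r ⟨hr, hrT⟩
    rw [mem_preimage, mem_ofPred_eq, hTx, searchTime_le_coe_iff hc] at hrT
    obtain ⟨s', hs', hr'⟩ := hrT
    have := hm v s' hs'
    rw [hr', coord_arc_self hr.1.le hr.2] at this
    exact ⟨hr.1, this⟩
  have hvar := sum_variation_le (F := fun t v => N.coord v (S t)) (sum_abs_coord_sub_le hS.2) s
    Finset.univ (a := 0) (fun _ _ => zero_le) zero_le (b := t) (fun v _ => hs v)
  simp only [Finset.mem_univ, if_true, hS.1, coord_node_root, sub_zero, ht, NNReal.coe_zero]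
    at hvar
  have hreal : 2 * ∑ v, N.coord v (S (s v)) ≤ t + ∑ v, N.coord v x := by
    rw [← sub_le_iff_le_add, Finset.mul_sum, ← Finset.sum_sub_distrib]
    refine (Finset.sum_le_sum fun v _ => ?_).trans hvar
    linarith [le_abs_self (N.coord v (S (s v))), neg_abs_le (N.coord v x - N.coord v (S (s v)))]
  refine (mul_le_mul_right hlen 2).trans ?_
  rw [lengthMeasure_setOf_below, hTx, ← ENNReal.ofReal_coe_nnreal,
    ← ENNReal.ofReal_add t.coe_nonneg (Finset.sum_nonneg fun v _ => coord_nonneg v x),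
    ← ENNReal.ofReal_ofNat 2, ← ENNReal.ofReal_mul zero_le_two]
  exact ENNReal.ofReal_le_ofReal hreal

variable {h : Measure N.Point}

lemma lintegral_below_ne_top [IsFiniteMeasure h] :
    ∫⁻ x, N.lengthMeasure {y | N.Below y x} ∂h ≠ ∞ := by
  rw [lintegral_below]
  exact measure_ne_top _ _

lemma measurable_below : Measurable fun x : N.Point => N.lengthMeasure {y | N.Below y x} :=
  measurable_measure_prodMk_left (measurableSet_below_swap (N := N))

lemma lintegral_searchTime_add (hS : IsSearch S) :
    ∫⁻ x, (searchTime S x + N.lengthMeasure {y | N.Below y x}) ∂h =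
      expectedSearchTime S h + ∫⁻ x, N.lengthMeasure {y | N.Below y x} ∂h :=
  lintegral_add_left (measurable_searchTime hS.2.continuous) _

lemma IsMonotone.add_searchValue_le [IsFiniteMeasure h] (hmono : IsMonotone h) (hS : IsSearch S) :
    ∫⁻ x, N.lengthMeasure {y | N.Below y x} ∂h + searchValue h ≤
      ∫⁻ x, 2 * N.lengthMeasure {y | searchTime S y ≤ searchTime S x} ∂h := by
  refine (hmono.searchValue_le (measurable_searchTime hS.2.continuous)
    (searchTime_mono hS)).trans ?_
  exact lintegral_const_mul_le _ _

/-- No search has an expected search time below `searchValue h`. -/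
lemma IsMonotone.searchValue_le_expectedSearchTime [IsFiniteMeasure h] (hmono : IsMonotone h)
    (hS : IsSearch S) : searchValue h ≤ expectedSearchTime S h := by
  have h1 := (hmono.add_searchValue_le hS).trans (lintegral_mono (two_mul_lengthMeasure_le hS))
  rw [lintegral_searchTime_add hS, add_comm] at h1
  exact (ENNReal.add_le_add_iff_right lintegral_below_ne_top).1 h1

/-- A search with the minimal expected search time reaches almost every point so early that it
could return to the root within the time needed to traverse every arc twice. -/
lemma IsMonotone.ae_searchTime_add_le [IsFiniteMeasure h] (hmono : IsMonotone h)
    (hS : IsSearch S) (hle : expectedSearchTime S h ≤ searchValue h) :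
    ∀ᵐ x ∂h, searchTime S x + N.lengthMeasure {y | N.Below y x} ≤ 2 * N.lengthMeasure univ := by
  have hint : ∫⁻ x, (searchTime S x + N.lengthMeasure {y | N.Below y x}) ∂h ≤
      ∫⁻ x, 2 * N.lengthMeasure {y | searchTime S y ≤ searchTime S x} ∂h := by
    refine le_trans ?_ (hmono.add_searchValue_le hS)
    rw [lintegral_searchTime_add hS, add_comm]
    gcongr
  have hfin : ∫⁻ x, 2 * N.lengthMeasure {y | searchTime S y ≤ searchTime S x} ∂h ≠ ∞ := by
    refine ne_top_of_le_ne_top ?_ (lintegral_mono (two_mul_lengthMeasure_le hS))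
    rw [lintegral_searchTime_add hS]
    exact ENNReal.add_ne_top.2
      ⟨ne_top_of_le_ne_top searchValue_ne_top hle, lintegral_below_ne_top⟩
  have hmeas : Measurable fun x => searchTime S x + N.lengthMeasure {y | N.Below y x} :=
    (measurable_searchTime hS.2.continuous).add measurable_below
  filter_upwards [ae_eq_of_ae_le_of_lintegral_le
    (Eventually.of_forall (two_mul_lengthMeasure_le hS)) hfin hmeas.aemeasurable hint] with x hx
  rw [← hx]
  gcongr
  exact subset_univ _

/-! ### Tours -/

lemma lipschitzWith_comp {X Y Z : Type*} [PseudoEMetricSpace X] [PseudoEMetricSpace Y]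
    [PseudoEMetricSpace Z] {f : Y → Z} {g : X → Y} (hf : LipschitzWith 1 f)
    (hg : LipschitzWith 1 g) : LipschitzWith 1 fun t => f (g t) := by
  have h := hf.comp hg
  rwa [one_mul] at h

lemma lipschitzWith_ite_le {X : Type*} [PseudoMetricSpace X] {f g : ℝ≥0 → X} {c : ℝ≥0}
    (hf : LipschitzWith 1 f) (hg : LipschitzWith 1 g) (hfg : f c = g c) :
    LipschitzWith 1 fun t => if t ≤ c then f t else g t := by
  have key : ∀ a b, a ≤ b → dist (if a ≤ c then f a else g a) (if b ≤ c then f b else g b) ≤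
      dist a b := by
    intro a b hab
    have hf' := fun x y => hf.dist_le_mul x y
    have hg' := fun x y => hg.dist_le_mul x y
    simp only [NNReal.coe_one, one_mul] at hf' hg'
    by_cases hb : b ≤ c
    · rw [if_pos hb, if_pos (hab.trans hb)]
      exact hf' a b
    · rw [if_neg hb]
      split_ifs with ha
      · refine (dist_triangle _ (f c) _).trans ?_
        have h1 := hf' a c
        have h2 := hg' c b
        rw [← hfg] at h2
        refine (add_le_add h1 h2).trans_eq ?_
        have hac : (a : ℝ) ≤ c := ha
        have hcb : (c : ℝ) ≤ b := (not_le.1 hb).le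
        rw [NNReal.dist_eq, NNReal.dist_eq, NNReal.dist_eq, abs_of_nonpos (by linarith),
          abs_of_nonpos (by linarith), abs_of_nonpos (by linarith)]
        ring
      · exact hg' a b
  refine LipschitzWith.of_dist_le_mul fun a b => ?_
  rw [NNReal.coe_one, one_mul]
  rcases le_total a b with h | h
  · exact key a b h
  · rw [dist_comm, dist_comm a]
    exact key b a h

lemma ite_le_of_ge {X : Type*} {f g : ℝ≥0 → X} {c t : ℝ≥0} (hfg : f c = g c) (h : c ≤ t) :
    (if t ≤ c then f t else g t) = g t := by
  split_ifs with h'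
  · rw [le_antisymm h' h, hfg]
  · rfl

lemma lipschitzWith_sub_right (c : ℝ≥0) : LipschitzWith 1 fun t : ℝ≥0 => t - c :=
  LipschitzWith.of_dist_le_mul fun a b => by
    rw [NNReal.coe_one, one_mul, NNReal.dist_eq, NNReal.dist_eq, NNReal.coe_sub_def,
      NNReal.coe_sub_def]
    exact (abs_max_sub_max_le_abs _ _ _).trans_eq (by ring_nf)

lemma lipschitzWith_sub_left (c : ℝ≥0) : LipschitzWith 1 fun t : ℝ≥0 => c - t :=
  LipschitzWith.of_dist_le_mul fun a b => by
    rw [NNReal.coe_one, one_mul, NNReal.dist_eq, NNReal.dist_eq, NNReal.coe_sub_def,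
      NNReal.coe_sub_def, abs_sub_comm (a : ℝ)]
    exact (abs_max_sub_max_le_abs _ _ _).trans_eq (by ring_nf)

variable (N) in
/-- The time needed to traverse each of the arcs below the nodes in `W` twice. -/
def doubleLength (W : Finset V) : ℝ≥0 := ∑ v ∈ W, 2 * (N.arcLen v).toNNReal

/-- A search that visits all the nodes in `W` and is back at the root at the time that is needed to
traverse each of the arcs below these nodes twice. -/
def IsTour (W : Finset V) (S : ℝ≥0 → N.Point) : Prop :=
  IsSearch S ∧ S (N.doubleLength W) = N.node N.root ∧
    ∀ v ∈ W, ∃ t ≤ N.doubleLength W, S t = N.node v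

/-- A tour is extended to one more node by a detour. -/
lemma IsTour.insert {W : Finset V} (hS : IsTour W S) {v : V} (hv : v ∉ W) (hv0 : v ≠ N.root)
    (hp : N.par v ∈ W) : ∃ S' : ℝ≥0 → N.Point, IsTour (insert v W) S' := by
  obtain ⟨t₀, ht₀, hSt⟩ := hS.2.2 _ hp
  set τ := N.doubleLength W with hτ
  set L : ℝ≥0 := (N.arcLen v).toNNReal with hL
  have hLc : (L : ℝ) = N.arcLen v := Real.coe_toNNReal _ (N.arcLen_nonneg v)
  have hτ' : N.doubleLength (Insert.insert v W) = τ + 2 * L := by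
    rw [doubleLength, Finset.sum_insert hv, add_comm, hτ, doubleLength]
  let D : ℝ≥0 → N.Point := fun t => N.arc v (L - |(t : ℝ) - (t₀ + L)|)
  let E : ℝ≥0 → N.Point := fun t => S (t - 2 * L)
  let G : ℝ≥0 → N.Point := fun t => if t ≤ t₀ + 2 * L then D t else E t
  have hD : LipschitzWith 1 D := by
    have : LipschitzWith 1 fun t : ℝ≥0 => (L : ℝ) - |(t : ℝ) - (t₀ + L)| :=
      LipschitzWith.of_dist_le_mul fun a b => by
        rw [NNReal.coe_one, one_mul, NNReal.dist_eq, Real.dist_eq, sub_sub_sub_cancel_left]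
        refine (abs_abs_sub_abs_le _ _).trans_eq ?_
        rw [sub_sub_sub_cancel_right, abs_sub_comm]
    exact lipschitzWith_comp (lipschitzWith_arc v) this
  have hE : LipschitzWith 1 E := by
    exact lipschitzWith_comp hS.1.2 (lipschitzWith_sub_right (2 * L))
  have hDE : D (t₀ + 2 * L) = E (t₀ + 2 * L) := by
    have h1 : (L : ℝ) - |((t₀ + 2 * L : ℝ≥0) : ℝ) - (t₀ + L)| = 0 := by
      push_cast
      rw [show (t₀ : ℝ) + 2 * L - (t₀ + L) = L by ring, abs_of_nonneg L.coe_nonneg, sub_self]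
    simp only [D, E, h1]
    rw [arc_zero, add_tsub_cancel_right, hSt]
  have hSG : S t₀ = G t₀ := by
    have h1 : (L : ℝ) - |((t₀ : ℝ≥0) : ℝ) - (t₀ + L)| = 0 := by
      rw [show (t₀ : ℝ) - (t₀ + L) = -L by ring, abs_neg, abs_of_nonneg L.coe_nonneg, sub_self]
    simp only [G, if_pos (le_self_add : t₀ ≤ t₀ + 2 * L), D, h1]
    rw [arc_zero, hSt]
  have hGE : ∀ t, t₀ ≤ t → (if t + 2 * L ≤ t₀ then S (t + 2 * L) else G (t + 2 * L)) = S t := by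
    intro t ht
    rw [ite_le_of_ge hSG (ht.trans le_self_add)]
    simp only [G]
    rw [ite_le_of_ge hDE (by gcongr)]
    simp only [E, add_tsub_cancel_right]
  refine ⟨fun t => if t ≤ t₀ then S t else G t, ⟨?_, ?_⟩, ?_, ?_⟩
  · simp only [if_pos (zero_le : (0 : ℝ≥0) ≤ t₀)]
    exact hS.1.1
  · exact lipschitzWith_ite_le hS.1.2 (lipschitzWith_ite_le hD hE hDE) hSG
  · rw [hτ']
    simp only
    rw [hGE τ ht₀]
    exact hS.2.1
  · rw [hτ']
    intro w hw
    rcases Finset.mem_insert.1 hw with rfl | hw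
    · refine ⟨t₀ + L, by rw [two_mul, ← add_assoc]; exact
        (add_le_add ht₀ le_rfl).trans le_self_add, ?_⟩
      simp only
      rw [ite_le_of_ge hSG le_self_add]
      have h1 : t₀ + L ≤ t₀ + 2 * L := by
        rw [two_mul]
        gcongr
        exact le_self_add
      simp only [G, if_pos h1, D, NNReal.coe_add, sub_self, abs_zero, sub_zero]
      rw [hLc, node_eq_arc]
    · obtain ⟨t, ht, htw⟩ := hS.2.2 w hw
      rcases le_or_gt t t₀ with h1 | h1
      · exact ⟨t, ht.trans le_self_add, by simp only [if_pos h1]; exact htw⟩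
      · refine ⟨t + 2 * L, by gcongr, ?_⟩
        simp only
        rw [hGE t h1.le, htw]

variable (N) in
lemma exists_isTour : ∃ S : ℝ≥0 → N.Point, IsTour Finset.univ S := by
  classical
  -- a largest set of nodes that contains the parents of its elements and has a tour
  let P : Finset V → Prop := fun W => N.root ∈ W ∧ (∀ v ∈ W, N.par v ∈ W) ∧
    ∃ S : ℝ≥0 → N.Point, IsTour W S
  have hP0 : P {N.root} := by
    refine ⟨Finset.mem_singleton_self _, ?_, fun _ => N.node N.root,
      ⟨rfl, LipschitzWith.const' _⟩, rfl, ?_⟩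
    · intro v hv
      rw [Finset.mem_singleton.1 hv, N.par_root]
      exact Finset.mem_singleton_self _
    · intro v hv
      rw [Finset.mem_singleton.1 hv]
      exact ⟨0, zero_le, rfl⟩
  obtain ⟨W, hW, hmax⟩ := (Finset.univ.filter P).exists_max_image Finset.card
    ⟨_, Finset.mem_filter.2 ⟨Finset.mem_univ _, hP0⟩⟩
  obtain ⟨hroot, hpar, S, hS⟩ := (Finset.mem_filter.1 hW).2
  by_cases hu : W = Finset.univ
  · exact ⟨S, hu ▸ hS⟩
  exfalso
  obtain ⟨v, hv, hvmin⟩ := (Wᶜ).exists_min_image N.depth (by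
    rw [Finset.nonempty_iff_ne_empty]
    exact fun h => hu (Finset.compl_eq_empty_iff W |>.1 h))
  rw [Finset.mem_compl] at hv
  have hv0 : v ≠ N.root := fun h => hv (h ▸ hroot)
  have hp : N.par v ∈ W := by
    by_contra hp
    have := hvmin _ (Finset.mem_compl.2 hp)
    rw [depth_par hv0] at this
    omega
  obtain ⟨S', hS'⟩ := hS.insert hv hv0 hp
  have hP : P (insert v W) := by
    refine ⟨Finset.mem_insert_of_mem hroot, fun w hw => ?_, S', hS'⟩
    rcases Finset.mem_insert.1 hw with rfl | hw
    · exact Finset.mem_insert_of_mem hp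
    · exact Finset.mem_insert_of_mem (hpar w hw)
  have := hmax _ (Finset.mem_filter.2 ⟨Finset.mem_univ _, hP⟩)
  rw [Finset.card_insert_of_notMem hv] at this
  omega

variable (N) in
/-- The time needed to traverse all the arcs of the network twice. -/
def tourLength : ℝ≥0 := N.doubleLength Finset.univ

lemma coe_tourLength : (N.tourLength : ℝ) = 2 * ∑ v, N.arcLen v := by
  rw [tourLength, doubleLength, NNReal.coe_sum, Finset.mul_sum]
  refine Finset.sum_congr rfl fun v _ => ?_
  rw [NNReal.coe_mul, Real.coe_toNNReal _ (N.arcLen_nonneg v)]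
  rfl

lemma coe_tourLength_eq : (N.tourLength : ℝ≥0∞) = 2 * N.lengthMeasure univ := by
  rw [lengthMeasure_univ, ← ENNReal.ofReal_coe_nnreal, coe_tourLength,
    ENNReal.ofReal_mul zero_le_two, ENNReal.ofReal_ofNat]

/-- The tour traversed backwards. -/
lemma IsTour.reverse (hS : IsTour Finset.univ S) :
    IsTour Finset.univ fun t => S (N.tourLength - t) := by
  refine ⟨⟨?_, ?_⟩, ?_, fun v hv => ?_⟩
  · simp only [tsub_zero]
    exact hS.2.1
  · exact lipschitzWith_comp hS.1.2 (lipschitzWith_sub_left N.tourLength)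
  · change S (N.tourLength - N.tourLength) = _
    rw [tsub_self]
    exact hS.1.1
  · obtain ⟨t, ht, htv⟩ := hS.2.2 v hv
    refine ⟨N.tourLength - t, (tsub_le_self : N.tourLength - t ≤ N.tourLength), ?_⟩
    change S (N.tourLength - (N.tourLength - t)) = _
    rw [tsub_tsub_cancel_of_le (show t ≤ N.tourLength from ht), htv]

lemma IsTour.exists_visit (hS : IsTour Finset.univ S) (x : N.Point) :
    ∃ t ≤ N.tourLength, S t = x := by
  obtain ⟨v, hv⟩ := exists_below_node x
  obtain ⟨t, ht, htv⟩ := hS.2.2 v (Finset.mem_univ v)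
  obtain ⟨s, hs, hsx⟩ := exists_visit_of_below hS.1.2.continuous hS.1.1 htv hv
  exact ⟨s, hs.trans ht, hsx⟩

/-- Between the first and the last visit of a point `x`, a tour traverses the subtree at `x` twice.
The last visit is the first visit of the reversed tour. -/
lemma IsTour.searchTime_add_le (hS : IsTour Finset.univ S) (x : N.Point) :
    searchTime S x + searchTime (fun t => S (N.tourLength - t)) x +
      2 * N.lengthMeasure (N.subtreeAt x) ≤ 2 * N.lengthMeasure univ := by
  have hR := hS.reverse
  set R : ℝ≥0 → N.Point := fun t => S (N.tourLength - t) with hRdef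
  have first : ∀ {S : ℝ≥0 → N.Point}, IsTour Finset.univ S →
      ∃ a ≤ N.tourLength, S a = x ∧ searchTime S x = a ∧ ∀ s, S s = x → a ≤ s := by
    intro S hS
    obtain ⟨t, ht, htx⟩ := hS.exists_visit x
    obtain ⟨a, hax, ha, hmin⟩ := exists_searchTime_eq hS.1.2.continuous
      (ne_top_of_le_ne_top ENNReal.coe_ne_top (searchTime_le htx))
    exact ⟨a, (hmin t htx).trans ht, hax, ha, hmin⟩
  obtain ⟨a, ha, hax, hTa, hamin⟩ := first hS
  obtain ⟨a', ha', hax', hTa', hamin'⟩ := first hR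
  have hvis : ∀ v, ∃ s ≤ N.tourLength, S s = N.node v := fun v => hS.exists_visit _
  choose s hs hsv using hvis
  classical
  let A : Finset V := Finset.univ.filter fun v => N.Below x (N.node v)
  have hA : ∀ {v}, v ∈ A ↔ N.Below x (N.node v) := by simp [A]
  have hab : a ≤ N.tourLength - a' := hamin _ hax'
  have hlow : ∀ v ∈ A, a ≤ s v := by
    intro v hv
    obtain ⟨r, hr, hrx⟩ := exists_visit_of_below hS.1.2.continuous hS.1.1 (hsv v) (hA.1 hv)
    exact (hamin r hrx).trans hr
  have hupp : ∀ v ∈ A, s v ≤ N.tourLength - a' := by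
    intro v hv
    have : R (N.tourLength - s v) = N.node v := by
      simp only [hRdef]
      rw [tsub_tsub_cancel_of_le (hs v), hsv]
    obtain ⟨r, hr, hrx⟩ := exists_visit_of_below hR.1.2.continuous hR.1.1 this (hA.1 hv)
    exact le_tsub_of_add_le_left ((add_le_add ((hamin' r hrx).trans hr) le_rfl).trans_eq
      (tsub_add_cancel_of_le (hs v)))
  have hvar := sum_variation_le (F := fun t v => N.coord v (S t)) (sum_abs_coord_sub_le hS.1.2) s
    A hlow hab hupp
  have hax'' : S (N.tourLength - a') = x := hax'
  simp only [hax, hax'', hsv, coord_node_self, sub_self, abs_zero] at hvar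
  rw [NNReal.coe_sub ha'] at hvar
  have hlen : N.lengthMeasure (N.subtreeAt x) ≤
      ENNReal.ofReal (∑ v ∈ A, (N.arcLen v - N.coord v x)) := by
    rw [lengthMeasure_apply (measurableSet_subtreeAt x), ENNReal.ofReal_sum_of_nonneg
      fun v _ => sub_nonneg.2 (coord_le v x), ← Finset.sum_subset (Finset.subset_univ A)]
    · refine Finset.sum_le_sum fun v _ => ?_
      rw [← Real.volume_Icc]
      refine measure_mono ?_
      rintro r ⟨hr, hrx : N.Below x (N.arc v r)⟩
      have := below_iff.1 hrx v
      rw [coord_arc_self hr.1.le hr.2] at this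
      exact ⟨this, hr.2⟩
    · intro v _ hv
      have : Ioc 0 (N.arcLen v) ∩ N.arc v ⁻¹' N.subtreeAt x = ∅ := by
        refine eq_empty_of_forall_notMem fun r hr => hv (hA.2 ?_)
        exact Below.trans hr.2 (arc_below_node v r)
      rw [this, measure_empty]
  have hnn : 0 ≤ ∑ v ∈ A, (N.arcLen v - N.coord v x) :=
    Finset.sum_nonneg fun v _ => sub_nonneg.2 (coord_le v x)
  have hreal : (a : ℝ) + a' + 2 * ∑ v ∈ A, (N.arcLen v - N.coord v x) ≤ N.tourLength := by
    have h1 : 2 * ∑ v ∈ A, (N.arcLen v - N.coord v x) ≤ (N.tourLength : ℝ) - a' - a := by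
      refine le_trans (le_of_eq ?_) hvar
      rw [Finset.sum_ite, Finset.sum_const_zero, add_zero, Finset.mul_sum]
      refine Finset.sum_congr (by ext; simp) fun v _ => ?_
      have := coord_le v x
      rw [abs_of_nonneg (by linarith), abs_of_nonpos (by linarith)]
      ring
    linarith
  rw [hTa, hTa', ← coe_tourLength_eq]
  refine (add_le_add_right (mul_le_mul_right hlen 2) _).trans ?_
  rw [← ENNReal.ofReal_ofNat 2, ← ENNReal.ofReal_mul zero_le_two, ← ENNReal.ofReal_coe_nnreal,
    ← ENNReal.ofReal_coe_nnreal, ← ENNReal.ofReal_coe_nnreal,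
    ← ENNReal.ofReal_add a.coe_nonneg a'.coe_nonneg,
    ← ENNReal.ofReal_add (by positivity) (by positivity)]
  exact ENNReal.ofReal_le_ofReal hreal

/-- The expected search times of a tour and the reversed tour have the mean `searchValue h`, so
both are equal to it. -/
lemma IsTour.expectedSearchTime_le [IsFiniteMeasure h] (hmono : IsMonotone h)
    (hS : IsTour Finset.univ S) : expectedSearchTime S h ≤ searchValue h := by
  have hR := hS.reverse
  set R : ℝ≥0 → N.Point := fun t => S (N.tourLength - t)
  classical
  have hpt : ∀ x, searchTime S x + searchTime R x ≤ 2 * (N.lengthMeasure {y | N.Below y x} +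
      ∑ p ∈ N.siblingPairs,
        (N.branch p.1).indicator (fun _ => N.lengthMeasure (N.branch p.2)) x) := by
    intro x
    have h1 := (hS.searchTime_add_le x).trans (mul_le_mul_right (lengthMeasure_univ_le x) 2)
    rw [mul_add, add_comm (2 * N.lengthMeasure (N.subtreeAt x))] at h1
    refine (ENNReal.add_le_add_iff_right ?_).1 h1
    exact ENNReal.mul_ne_top ENNReal.ofNat_ne_top (measure_ne_top _ _)
  have hsum : expectedSearchTime S h + expectedSearchTime R h ≤ searchValue h + searchValue h := by
    rw [← two_mul, ← lintegral_below_add_siblings, ← lintegral_const_mul' _ _ ENNReal.ofNat_ne_top,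
      expectedSearchTime, expectedSearchTime,
      ← lintegral_add_left (measurable_searchTime hS.1.2.continuous)]
    exact lintegral_mono hpt
  have hR' := hmono.searchValue_le_expectedSearchTime hR.1
  exact (ENNReal.add_le_add_iff_right searchValue_ne_top).1
    ((add_le_add_right hR' _).trans hsum)

lemma IsTour.isOptimal [IsFiniteMeasure h] (hmono : IsMonotone h)
    (hS : IsTour Finset.univ S) : IsOptimal h S :=
  ⟨hS.1, fun _ hS' => (hS.expectedSearchTime_le hmono).trans
    (hmono.searchValue_le_expectedSearchTime hS')⟩

end Searches

/-! ### Tours are depth-first -/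

section Phases

variable {V : Type*} [Fintype V] [DecidableEq V] {N : TreeNetwork V} {S : ℝ≥0 → N.Point}

/-- A time at which a tour is at the node `v`. -/
def peak (hS : IsTour Finset.univ S) (v : V) : ℝ≥0 := (hS.2.2 v (Finset.mem_univ v)).choose

/-- The progress of a tour on the arc below `v`: it runs from `0` to the length of the arc while the
arc is traversed upwards, and on to twice the length while the arc is traversed downwards. -/
def phase (hS : IsTour Finset.univ S) (v : V) (t : ℝ≥0) : ℝ :=
  if t ≤ peak hS v then N.coord v (S t) else 2 * N.arcLen v - N.coord v (S t)

variable (hS : IsTour Finset.univ S)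

include hS in
lemma apply_tourLength : S N.tourLength = N.node N.root := hS.2.1

lemma peak_le (v : V) : peak hS v ≤ N.tourLength := (hS.2.2 v (Finset.mem_univ v)).choose_spec.1

lemma apply_peak (v : V) : S (peak hS v) = N.node v :=
  (hS.2.2 v (Finset.mem_univ v)).choose_spec.2

lemma phase_zero (v : V) : phase hS v 0 = 0 := by
  rw [phase, if_pos zero_le, hS.1.1, coord_node_root]

lemma phase_tourLength (v : V) : phase hS v N.tourLength = 2 * N.arcLen v := by
  rw [phase]
  split_ifs with h
  · have h1 := apply_peak hS v
    rw [(peak_le hS v).antisymm h, apply_tourLength hS] at h1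
    rw [← node_injective h1, arcLen_root, coord_root, mul_zero]
  · rw [apply_tourLength hS, coord_node_root, sub_zero]

lemma phase_root (t : ℝ≥0) : phase hS N.root t = 0 := by
  rw [phase, coord_root, arcLen_root]
  simp

lemma phase_le (v : V) (t : ℝ≥0) : phase hS v t ≤ 2 * N.arcLen v := by
  have h1 := coord_nonneg v (S t)
  have h2 := coord_le v (S t)
  rw [phase]
  split_ifs <;> linarith

lemma coord_eq_phase {v : V} {t : ℝ≥0} (h : phase hS v t < N.arcLen v) :
    N.coord v (S t) = phase hS v t := by
  rw [phase] at h ⊢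
  split_ifs at h ⊢
  · rfl
  · linarith [coord_le v (S t)]

lemma coord_eq_sub_phase {v : V} {t : ℝ≥0} (h : N.arcLen v < phase hS v t) :
    N.coord v (S t) = 2 * N.arcLen v - phase hS v t := by
  rw [phase] at h ⊢
  split_ifs at h ⊢
  · linarith [coord_le v (S t)]
  · ring

lemma phase_eq_arcLen_iff {v : V} {t : ℝ≥0} :
    phase hS v t = N.arcLen v ↔ N.coord v (S t) = N.arcLen v := by
  rw [phase]
  split_ifs
  · rfl
  · constructor <;> intro h <;> linarith

lemma phase_mem_of_coord_mem {v : V} {t : ℝ≥0}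
    (h : N.coord v (S t) = 0 ∨ N.coord v (S t) = N.arcLen v) :
    phase hS v t ∈ ({0, N.arcLen v, 2 * N.arcLen v} : Set ℝ) := by
  rw [mem_insert_iff, mem_insert_iff, mem_singleton_iff, phase]
  split_ifs
  · tauto
  · rcases h with h | h <;> rw [h]
    · exact Or.inr (Or.inr (by ring))
    · exact Or.inr (Or.inl (by ring))

lemma sum_abs_phase_sub_le {a b : ℝ≥0} (hab : a ≤ b) :
    ∑ v, |phase hS v b - phase hS v a| ≤ b - a := by
  have h := sum_variation_le (F := fun t v => N.coord v (S t)) (sum_abs_coord_sub_le hS.1.2)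
    (peak hS) (Finset.univ.filter fun v => a ≤ peak hS v ∧ peak hS v ≤ b) (a := a)
    (fun v hv => (Finset.mem_filter.1 hv).2.1) hab (fun v hv => (Finset.mem_filter.1 hv).2.2)
  refine (Finset.sum_le_sum fun v _ => ?_).trans h
  simp only [Finset.mem_filter, Finset.mem_univ, true_and, apply_peak, coord_node_self]
  split_ifs with hv
  · have h1 : phase hS v a = N.coord v (S a) := by rw [phase, if_pos hv.1]
    have h2 : phase hS v b = 2 * N.arcLen v - N.coord v (S b) := by
      rw [phase]
      split_ifs with hb
      · rw [hb.antisymm hv.2, apply_peak hS, coord_node_self]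
        ring
      · rfl
    rw [h1, h2, abs_sub_comm (N.coord v (S b))]
    refine (le_of_eq ?_).trans (abs_add_le _ _)
    ring_nf
  · by_cases ha : a ≤ peak hS v
    · have hb : b ≤ peak hS v := by
        by_contra hb
        exact hv ⟨ha, (not_le.1 hb).le⟩
      rw [phase, phase, if_pos ha, if_pos hb]
    · rw [phase, phase, if_neg ha, if_neg fun hb => ha (hab.trans hb), abs_sub_comm]
      refine le_of_eq ?_
      ring_nf

/-- A tour has no time to lose: at every time it moves at unit speed and makes progress. -/
lemma sum_phase {t : ℝ≥0} (ht : t ≤ N.tourLength) : ∑ v, phase hS v t = t := by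
  have h1 : ∑ v, phase hS v t ≤ t := by
    have h := sum_abs_phase_sub_le hS (zero_le : 0 ≤ t)
    simp only [phase_zero, sub_zero, NNReal.coe_zero] at h
    exact (Finset.sum_le_sum fun v _ => le_abs_self _).trans h
  have h2 : ∑ v, (2 * N.arcLen v - phase hS v t) ≤ N.tourLength - t := by
    have h := sum_abs_phase_sub_le hS ht
    simp only [phase_tourLength] at h
    exact (Finset.sum_le_sum fun v _ => le_abs_self _).trans h
  rw [Finset.sum_sub_distrib, ← Finset.mul_sum, ← coe_tourLength] at h2
  linarith

lemma phase_mono {a b : ℝ≥0} (hab : a ≤ b) (hb : b ≤ N.tourLength) (v : V) :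
    phase hS v a ≤ phase hS v b := by
  have h1 := sum_abs_phase_sub_le hS hab
  rw [← sum_phase hS hb, ← sum_phase hS (hab.trans hb), ← Finset.sum_sub_distrib] at h1
  have h2 := (Finset.sum_eq_sum_iff_of_le fun v _ => le_abs_self _).1
    (le_antisymm (Finset.sum_le_sum fun v _ => le_abs_self _) h1) v (Finset.mem_univ v)
  linarith [abs_nonneg (phase hS v b - phase hS v a)]

lemma abs_phase_sub_le {a b : ℝ≥0} (hab : a ≤ b) (v : V) :
    |phase hS v b - phase hS v a| ≤ b - a :=
  (Finset.single_le_sum (f := fun v => |phase hS v b - phase hS v a|)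
    (fun _ _ => abs_nonneg _) (Finset.mem_univ v)).trans (sum_abs_phase_sub_le hS hab)

lemma continuous_phase (v : V) : Continuous (phase hS v) := by
  refine (LipschitzWith.of_dist_le_mul (K := 1) fun a b => ?_).continuous
  rw [NNReal.coe_one, one_mul, NNReal.dist_eq, Real.dist_eq]
  rcases le_total a b with h | h
  · rw [abs_sub_comm, abs_sub_comm (a : ℝ)]
    exact (abs_phase_sub_le hS h v).trans (le_abs_self _)
  · exact (abs_phase_sub_le hS h v).trans (le_abs_self _)

/-- At an interior point of an arc, the coordinates of the other arcs have extreme values. -/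
lemma coord_of_ne {v w : V} (hne : w ≠ v) {x : N.Point} (h0 : 0 < N.coord v x)
    (h1 : N.coord v x < N.arcLen v) : N.coord w x = 0 ∨ N.coord w x = N.arcLen w := by
  rw [eq_arc_of_coord h0 h1]
  by_cases ha : N.Anc w v
  · exact Or.inr (coord_arc_of_anc hne ha _)
  · exact Or.inl (coord_arc_of_not_anc hne ha _)

/-- A directed arc: the arc between `v` and its parent, directed towards `v` for `(v, false)` and
towards the parent of `v` for `(v, true)`. -/
abbrev DirArc (V : Type*) := V × Bool

/-- The phase of the arc at the beginning of the traversal of a directed arc. -/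
def base (N : TreeNetwork V) (d : DirArc V) : ℝ := if d.2 then N.arcLen d.1 else 0

/-- The node at which a directed arc begins. -/
def src (N : TreeNetwork V) (d : DirArc V) : V := if d.2 then d.1 else N.par d.1

/-- The node at which a directed arc ends. -/
def tgt (N : TreeNetwork V) (d : DirArc V) : V := if d.2 then N.par d.1 else d.1

/-- The point at distance `r` from the beginning of a directed arc. -/
def dirPoint (N : TreeNetwork V) (d : DirArc V) (r : ℝ) : N.Point :=
  N.arc d.1 (if d.2 then N.arcLen d.1 - r else r)

lemma dirPoint_zero (d : DirArc V) : N.dirPoint d 0 = N.node (N.src d) := by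
  obtain ⟨v, _ | _⟩ := d
  · simp [dirPoint, src, arc_zero]
  · simp [dirPoint, src, node_eq_arc]

lemma dirPoint_arcLen (d : DirArc V) : N.dirPoint d (N.arcLen d.1) = N.node (N.tgt d) := by
  obtain ⟨v, _ | _⟩ := d
  · simp [dirPoint, tgt, node_eq_arc]
  · simp [dirPoint, tgt, arc_zero]

lemma dist_dirPoint (d : DirArc V) {r s : ℝ} (hr : r ∈ Icc 0 (N.arcLen d.1))
    (hs : s ∈ Icc 0 (N.arcLen d.1)) : dist (N.dirPoint d r) (N.dirPoint d s) = |r - s| := by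
  obtain ⟨v, _ | _⟩ := d
  · simp only [dirPoint, Bool.false_eq_true, if_false]
    exact dist_arc_of_mem hr hs
  · simp only [dirPoint, if_true]
    rw [dist_arc_of_mem ⟨by linarith [hr.2], by linarith [hr.1]⟩
      ⟨by linarith [hs.2], by linarith [hs.1]⟩, sub_sub_sub_cancel_left, abs_sub_comm]

lemma continuous_dirPoint (d : DirArc V) : Continuous (N.dirPoint d) := by
  refine (lipschitzWith_arc d.1).continuous.comp ?_
  split_ifs <;> fun_prop

lemma len_dirArc {d : DirArc V} (hd : d.1 ≠ N.root) :
    N.len s(N.src d, N.tgt d) = N.arcLen d.1 := by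
  obtain ⟨v, _ | _⟩ := d
  · simp [src, tgt, arcLen, if_neg hd]
  · simp [src, tgt, arcLen, if_neg hd, Sym2.eq_swap]

lemma adj_dirArc {d : DirArc V} (hd : d.1 ≠ N.root) : N.graph.Adj (N.src d) (N.tgt d) := by
  obtain ⟨v, _ | _⟩ := d
  · exact par_adj hd
  · exact (par_adj hd).symm

lemma dirArc_injective {d d' : DirArc V} (hd : d.1 ≠ N.root) (hd' : d'.1 ≠ N.root)
    (hs : N.src d = N.src d') (ht : N.tgt d = N.tgt d') : d = d' := by
  obtain ⟨v, b⟩ := d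
  obtain ⟨w, b'⟩ := d'
  have h1 := depth_par hd
  have h2 := depth_par hd'
  cases b <;> cases b' <;> simp only [src, tgt, if_true, Bool.false_eq_true, if_false] at *
  · rw [ht]
  · rw [hs] at h1
    rw [← ht] at h2
    omega
  · rw [ht] at h1
    rw [← hs] at h2
    omega
  · rw [hs]

lemma exists_dirArc {u v : V} (h : N.graph.Adj u v) :
    ∃ d : DirArc V, d.1 ≠ N.root ∧ N.src d = u ∧ N.tgt d = v := by
  rcases adj_cases h with h | h
  · exact ⟨(v, false), h.1, by simp [src, h.2], by simp [tgt]⟩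
  · exact ⟨(u, true), h.1, by simp [src], by simp [tgt, h.2]⟩

lemma base_nonneg (d : DirArc V) : 0 ≤ N.base d := by
  unfold base
  split_ifs
  exacts [N.arcLen_nonneg _, le_rfl]

lemma base_add_le (d : DirArc V) : N.base d + N.arcLen d.1 ≤ 2 * N.arcLen d.1 := by
  have := N.arcLen_nonneg d.1
  unfold base
  split_ifs <;> linarith

/-- During the traversal of a directed arc the search is at the point given by the phase. -/
lemma apply_eq_dirPoint {d : DirArc V} {t : ℝ≥0} (h0 : N.base d < phase hS d.1 t)
    (h1 : phase hS d.1 t < N.base d + N.arcLen d.1) :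
    0 < N.coord d.1 (S t) ∧ N.coord d.1 (S t) < N.arcLen d.1 ∧
      S t = N.dirPoint d (phase hS d.1 t - N.base d) := by
  obtain ⟨v, _ | _⟩ := d
  · simp only [base, Bool.false_eq_true, if_false, zero_add, dirPoint, sub_zero] at *
    have h := coord_eq_phase hS h1
    refine ⟨by rw [h]; exact h0, by rw [h]; exact h1, ?_⟩
    rw [← h]
    exact eq_arc_of_coord (by rw [h]; exact h0) (by rw [h]; exact h1)
  · simp only [base, if_true, dirPoint] at *
    have h := coord_eq_sub_phase hS h0
    have h2 : 0 < N.coord v (S t) := by linarith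
    have h3 : N.coord v (S t) < N.arcLen v := by linarith
    refine ⟨h2, h3, ?_⟩
    rw [show N.arcLen v - (phase hS v t - N.arcLen v) = N.coord v (S t) by rw [h]; ring]
    exact eq_arc_of_coord h2 h3

/-- Every directed arc is traversed in a single run. While the search is in the interior of an arc,
the phases of the other arcs take values in a finite set, so they are constant. -/
lemma exists_start (d : DirArc V) (hd : d.1 ≠ N.root) : ∃ σ : ℝ≥0,
    σ + (N.arcLen d.1).toNNReal ≤ N.tourLength ∧
    ∀ t, σ ≤ t → t ≤ σ + (N.arcLen d.1).toNNReal → phase hS d.1 t = N.base d + (t - σ) := by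
  set v := d.1 with hv
  set c := N.base d with hc
  have hl := arcLen_pos hd
  have hc0 := base_nonneg (N := N) d
  have hc1 := base_add_le (N := N) d
  rw [← hc] at hc0
  rw [← hc, ← hv] at hc1
  have hcont := continuous_phase hS v
  -- every value is attained
  have hivt : ∀ {a b : ℝ≥0} {y : ℝ}, a ≤ b → phase hS v a ≤ y → y ≤ phase hS v b →
      ∃ t ∈ Icc a b, phase hS v t = y := by
    intro a b y hab h1 h2
    exact intermediate_value_Icc hab hcont.continuousOn ⟨h1, h2⟩
  obtain ⟨σ, hσ⟩ : ∃ σ, IsGreatest (Icc 0 N.tourLength ∩ {t | phase hS v t ≤ c}) σ :=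
    (isCompact_Icc.inter_right (isClosed_le hcont continuous_const)).exists_isGreatest
      ⟨0, ⟨le_rfl, zero_le⟩, by
        change phase hS v 0 ≤ c
        rw [phase_zero]
        exact hc0⟩
  obtain ⟨β, hβ⟩ : ∃ β, IsLeast (Icc 0 N.tourLength ∩ {t | c + N.arcLen v ≤ phase hS v t}) β :=
    (isCompact_Icc.inter_right (isClosed_le continuous_const hcont)).exists_isLeast
      ⟨N.tourLength, ⟨zero_le, le_rfl⟩, by
        change c + N.arcLen v ≤ phase hS v N.tourLength
        rw [phase_tourLength]
        exact hc1⟩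
  have hσΛ : σ ≤ N.tourLength := hσ.1.1.2
  have hβΛ : β ≤ N.tourLength := hβ.1.1.2
  have hσc : phase hS v σ = c := by
    obtain ⟨t, ht, htc⟩ := hivt hσΛ hσ.1.2 (by rw [phase_tourLength]; linarith)
    have hle : t ≤ σ := hσ.2 ⟨⟨zero_le, ht.2⟩, htc.le⟩
    rw [ht.1.antisymm hle, htc]
  have hβc : phase hS v β = c + N.arcLen v := by
    obtain ⟨t, ht, htc⟩ := hivt (zero_le : 0 ≤ β) (by rw [phase_zero]; linarith) hβ.1.2
    have hle : β ≤ t := hβ.2 ⟨⟨zero_le, ht.2.trans hβΛ⟩, htc.ge⟩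
    rw [hle.antisymm ht.2, htc]
  have hσβ : σ < β := by
    by_contra h
    have := phase_mono hS (not_lt.1 h) hσΛ v
    linarith
  have hlow : ∀ t ∈ Ioo σ β, c < phase hS v t := by
    intro t ht
    by_contra h
    exact (hσ.2 ⟨⟨zero_le, ht.2.le.trans hβΛ⟩, not_lt.1 h⟩ : t ≤ σ).not_gt ht.1
  have hupp : ∀ t ∈ Ioo σ β, phase hS v t < c + N.arcLen v := by
    intro t ht
    by_contra h
    exact (hβ.2 ⟨⟨zero_le, ht.2.le.trans hβΛ⟩, not_lt.1 h⟩ : β ≤ t).not_gt ht.2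
  have hconst : ∀ w, w ≠ v → ∀ a ∈ Ioo σ β, ∀ b ∈ Ioo σ β, phase hS w a = phase hS w b := by
    intro w hw a ha b hb
    have hmaps : MapsTo (phase hS w) (Ioo σ β) {0, N.arcLen w, 2 * N.arcLen w} := by
      intro t ht
      obtain ⟨h0, h1, -⟩ := apply_eq_dirPoint hS (hlow t ht) (hupp t ht)
      exact phase_mem_of_coord_mem hS (coord_of_ne hw h0 h1)
    exact isPreconnected_Ioo.constant_of_mapsTo (toFinite _).isDiscrete
      (continuous_phase hS w).continuousOn hmaps ha hb
  have hunit : ∀ a ∈ Ioo σ β, ∀ b ∈ Ioo σ β, phase hS v b - phase hS v a = b - a := by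
    intro a ha b hb
    rw [← sum_phase hS (hb.2.le.trans hβΛ), ← sum_phase hS (ha.2.le.trans hβΛ),
      ← Finset.sum_sub_distrib, Finset.sum_eq_single v]
    · intro w _ hw
      rw [hconst w hw a ha b hb, sub_self]
    · simp
  have hmid : ∀ t ∈ Ioo σ β, phase hS v t = c + (t - σ) := by
    intro t ht
    refine le_antisymm ?_ (le_of_forall_pos_le_add fun ε hε => ?_)
    · have := (le_abs_self _).trans (abs_phase_sub_le hS ht.1.le v)
      linarith
    · obtain ⟨a, ha1, ha2⟩ : ∃ a, σ < a ∧ a < min t (σ + ⟨ε, hε.le⟩) :=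
        exists_between (lt_min ht.1 (lt_add_of_pos_right σ hε))
      have ha : a ∈ Ioo σ β := ⟨ha1, (ha2.trans_le (min_le_left _ _)).trans ht.2⟩
      have h1 := hunit a ha t ht
      have h2 := hlow a ha
      have h3 : (a : ℝ) < σ + ε := NNReal.coe_lt_coe.2 (ha2.trans_le (min_le_right _ _))
      linarith
  have hβσ : (β : ℝ) = σ + N.arcLen v := by
    have h1 := (le_abs_self _).trans (abs_phase_sub_le hS hσβ.le v)
    rw [hβc, hσc] at h1
    refine le_antisymm (le_of_forall_lt fun x hx => ?_) (by linarith)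
    obtain ⟨t, ht1, ht2⟩ : ∃ t, max σ x.toNNReal < t ∧ t < β := by
      refine exists_between (max_lt hσβ ?_)
      rw [← NNReal.coe_lt_coe, Real.coe_toNNReal']
      exact max_lt hx (lt_of_le_of_lt σ.coe_nonneg (NNReal.coe_lt_coe.2 hσβ))
    have ht : t ∈ Ioo σ β := ⟨(le_max_left _ _).trans_lt ht1, ht2⟩
    have h2 := hupp t ht
    rw [hmid t ht] at h2
    have h3 : x < t := (Real.le_coe_toNNReal x).trans_lt
      (NNReal.coe_lt_coe.2 ((le_max_right _ _).trans_lt ht1))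
    linarith
  have hβ' : σ + (N.arcLen v).toNNReal = β := by
    rw [← NNReal.coe_inj, NNReal.coe_add, Real.coe_toNNReal _ hl.le, hβσ]
  refine ⟨σ, hβ' ▸ hβΛ, fun t h1 h2 => ?_⟩
  rw [hβ'] at h2
  rcases h1.eq_or_lt with rfl | h1
  · rw [hσc, sub_self, add_zero]
  · rcases h2.eq_or_lt with rfl | h2
    · rw [hβc, hβσ]
      ring
    · exact hmid t ⟨h1, h2⟩

end Phases

section Runs

variable {V : Type*} [Fintype V] [DecidableEq V] {N : TreeNetwork V} {S : ℝ≥0 → N.Point}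

/-- The time at which a tour begins to traverse the directed arc `d` (and `0` if there is no such
arc because `d.1` is the root). -/
def start (hS : IsTour Finset.univ S) (d : DirArc V) : ℝ≥0 :=
  if hd : d.1 ≠ N.root then (exists_start hS d hd).choose else 0

variable (hS : IsTour Finset.univ S) {d : DirArc V} (hd : d.1 ≠ N.root)

include hd

lemma start_spec : start hS d + (N.arcLen d.1).toNNReal ≤ N.tourLength ∧
    ∀ t, start hS d ≤ t → t ≤ start hS d + (N.arcLen d.1).toNNReal →
      phase hS d.1 t = N.base d + (t - start hS d) := by
  rw [start, dif_pos hd]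
  exact (exists_start hS d hd).choose_spec

lemma start_add_le : (start hS d : ℝ) + N.arcLen d.1 ≤ N.tourLength := by
  have h := NNReal.coe_le_coe.2 (start_spec hS hd).1
  rwa [NNReal.coe_add, Real.coe_toNNReal _ (N.arcLen_nonneg _)] at h

lemma start_lt : start hS d < N.tourLength := by
  rw [← NNReal.coe_lt_coe]
  linarith [start_add_le hS hd, arcLen_pos hd]

lemma phase_of_mem {t : ℝ≥0} (h0 : start hS d ≤ t) (h1 : (t : ℝ) ≤ start hS d + N.arcLen d.1) :
    phase hS d.1 t = N.base d + (t - start hS d) := by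
  refine (start_spec hS hd).2 t h0 ?_
  rwa [← NNReal.coe_le_coe, NNReal.coe_add, Real.coe_toNNReal _ (N.arcLen_nonneg _)]

lemma phase_le_of_le_start {t : ℝ≥0} (h : t ≤ start hS d) : phase hS d.1 t ≤ N.base d := by
  refine (phase_mono hS h (start_lt hS hd).le d.1).trans_eq ?_
  rw [phase_of_mem hS hd le_rfl (by linarith [arcLen_pos hd]), sub_self, add_zero]

lemma le_phase_of_ge {t : ℝ≥0} (h : (start hS d : ℝ) + N.arcLen d.1 ≤ t) (ht : t ≤ N.tourLength) :
    N.base d + N.arcLen d.1 ≤ phase hS d.1 t := by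
  have hc : ((start hS d + (N.arcLen d.1).toNNReal : ℝ≥0) : ℝ) = start hS d + N.arcLen d.1 := by
    rw [NNReal.coe_add, Real.coe_toNNReal _ (N.arcLen_nonneg _)]
  refine le_trans (le_of_eq ?_) (phase_mono hS (a := start hS d + (N.arcLen d.1).toNNReal)
    (by rwa [← NNReal.coe_le_coe, hc]) ht d.1)
  rw [phase_of_mem hS hd le_self_add hc.le, hc]
  ring

lemma start_le_of_phase_le {t : ℝ≥0} (ht : t ≤ N.tourLength) (h : phase hS d.1 t ≤ N.base d) :
    t ≤ start hS d := by
  by_contra hlt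
  rw [not_le, ← NNReal.coe_lt_coe] at hlt
  have hl := arcLen_pos hd
  rcases le_total ((start hS d : ℝ) + N.arcLen d.1) t with h1 | h1
  · linarith [le_phase_of_ge hS hd h1 ht]
  · linarith [phase_of_mem hS hd (NNReal.coe_le_coe.1 hlt.le) h1]

lemma apply_of_mem {t : ℝ≥0} (h0 : start hS d ≤ t) (h1 : (t : ℝ) ≤ start hS d + N.arcLen d.1) :
    S t = N.dirPoint d (t - start hS d) := by
  have hl : 0 < (N.arcLen d.1).toNNReal := Real.toNNReal_pos.2 (arcLen_pos hd)
  have heq : EqOn S (fun t : ℝ≥0 => N.dirPoint d (t - start hS d))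
      (Ioo (start hS d) (start hS d + (N.arcLen d.1).toNNReal)) := by
    intro t ht
    have ht1 : (start hS d : ℝ) < t := NNReal.coe_lt_coe.2 ht.1
    have ht2 : (t : ℝ) < start hS d + N.arcLen d.1 := by
      have := NNReal.coe_lt_coe.2 ht.2
      rwa [NNReal.coe_add, Real.coe_toNNReal _ (N.arcLen_nonneg _)] at this
    have hp := phase_of_mem hS hd ht.1.le ht2.le
    have := (apply_eq_dirPoint hS (d := d) (t := t) (by linarith) (by linarith)).2.2
    rw [this, hp]
    simp
  have hcl := heq.closure hS.1.2.continuous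
    ((continuous_dirPoint d).comp (NNReal.continuous_coe.sub continuous_const))
  rw [closure_Ioo (lt_add_of_pos_right _ hl).ne] at hcl
  refine hcl ⟨h0, ?_⟩
  rwa [← NNReal.coe_le_coe, NNReal.coe_add, Real.coe_toNNReal _ (N.arcLen_nonneg _)]

/-- The traversals of different directed arcs do not overlap. -/
lemma eq_of_overlap {d' : DirArc V} (hd' : d'.1 ≠ N.root) {t : ℝ≥0}
    (h0 : start hS d < t) (h1 : (t : ℝ) < start hS d + N.arcLen d.1)
    (h0' : start hS d' < t) (h1' : (t : ℝ) < start hS d' + N.arcLen d'.1) : d = d' := by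
  have ht : (start hS d : ℝ) < t := NNReal.coe_lt_coe.2 h0
  have ht' : (start hS d' : ℝ) < t := NNReal.coe_lt_coe.2 h0'
  have hp := phase_of_mem hS hd h0.le h1.le
  have hp' := phase_of_mem hS hd' h0'.le h1'.le
  obtain ⟨hc0, hc1, -⟩ := apply_eq_dirPoint hS (d := d) (t := t) (by linarith) (by linarith)
  obtain ⟨hc0', hc1', -⟩ := apply_eq_dirPoint hS (d := d') (t := t) (by linarith) (by linarith)
  have hv : d.1 = d'.1 := by
    by_contra hne
    rcases coord_of_ne hne hc0' hc1' with h | h <;> linarith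
  obtain ⟨v, b⟩ := d
  obtain ⟨w, b'⟩ := d'
  simp only at hv
  subst hv
  simp only [base] at hp hp' h1 h1'
  cases b <;> cases b' <;> simp only [if_true, Bool.false_eq_true, if_false] at hp hp' ⊢ <;>
    linarith

omit hd

/-- Whenever a tour is at a node before its end, it begins to traverse an arc at that node: the
phases cannot change before the next traversal begins, but they add up to the time. -/
lemma exists_next {τ : ℝ≥0} (hτ : τ < N.tourLength) {u : V} (hu : S τ = N.node u) :
    ∃ d : DirArc V, d.1 ≠ N.root ∧ start hS d = τ ∧ N.src d = u := by
  classical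
  have hphase : ∀ v, phase hS v τ ∈ ({0, N.arcLen v, 2 * N.arcLen v} : Set ℝ) := by
    intro v
    refine phase_mem_of_coord_mem hS ?_
    rw [hu, coord_node]
    split_ifs
    exacts [Or.inr rfl, Or.inl rfl]
  -- an arc with an unfinished phase has a traversal that begins at the present value of the phase
  have hnext : ∀ v, phase hS v τ < 2 * N.arcLen v →
      ∃ d : DirArc V, d.1 = v ∧ d.1 ≠ N.root ∧ τ ≤ start hS d ∧ phase hS v τ = N.base d := by
    intro v hlt
    have hv : v ≠ N.root := by
      rintro rfl
      rw [phase_root, arcLen_root, mul_zero] at hlt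
      exact lt_irrefl _ hlt
    have : ∃ d : DirArc V, d.1 = v ∧ phase hS v τ = N.base d := by
      rcases hphase v with h | h | h
      · exact ⟨(v, false), rfl, by simp [base, h]⟩
      · exact ⟨(v, true), rfl, by simp [base, h]⟩
      · exact absurd h hlt.ne
    obtain ⟨d, rfl, hdp⟩ := this
    exact ⟨d, rfl, hv, start_le_of_phase_le hS hv hτ.le hdp.le, hdp⟩
  let T : Finset (DirArc V) := Finset.univ.filter fun d => d.1 ≠ N.root ∧ τ ≤ start hS d
  have hT : T.Nonempty := by
    have : ∃ v ∈ Finset.univ, phase hS v τ < phase hS v N.tourLength := by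
      refine Finset.exists_lt_of_sum_lt ?_
      rw [sum_phase hS hτ.le, sum_phase hS le_rfl]
      exact_mod_cast hτ
    obtain ⟨v, -, hv⟩ := this
    rw [phase_tourLength] at hv
    obtain ⟨d, -, hd, hle, -⟩ := hnext v hv
    exact ⟨d, Finset.mem_filter.2 ⟨Finset.mem_univ _, hd, hle⟩⟩
  obtain ⟨d, hdT, hmin⟩ := T.exists_min_image (start hS) hT
  obtain ⟨hd, hτd⟩ := (Finset.mem_filter.1 hdT).2
  have hσ := (start_lt hS hd).le
  have hconst : ∀ v, phase hS v (start hS d) = phase hS v τ := by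
    intro v
    refine le_antisymm ?_ (phase_mono hS hτd hσ v)
    by_cases hlt : phase hS v τ < 2 * N.arcLen v
    · obtain ⟨d', rfl, hd', hle, hb⟩ := hnext v hlt
      rw [hb]
      exact phase_le_of_le_start hS hd'
        (hmin d' (Finset.mem_filter.2 ⟨Finset.mem_univ _, hd', hle⟩))
    · exact (phase_le hS v _).trans (not_lt.1 hlt)
  have heq : start hS d = τ := by
    rw [← NNReal.coe_inj, ← sum_phase hS hσ, ← sum_phase hS hτ.le]
    exact Finset.sum_congr rfl fun v _ => hconst v
  refine ⟨d, hd, heq, node_injective (N := N) ?_⟩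
  rw [← hu, ← heq, apply_of_mem hS hd le_rfl (by linarith [arcLen_pos hd]), sub_self,
    dirPoint_zero]

/-- From any time at which a tour is at a node, its remainder is the traversal of a walk. -/
lemma exists_walk_from {τ : ℝ≥0} (hτ : τ ≤ N.tourLength) {u : V} (hu : S τ = N.node u) :
    ∃ q : N.graph.Walk u N.root,
      (τ + ∑ j ∈ Finset.range q.length, N.len s(q.getVert j, q.getVert (j + 1)) : ℝ) =
        N.tourLength ∧
      ∀ i < q.length, ∃ d : DirArc V, d.1 ≠ N.root ∧
        (start hS d : ℝ) = τ + ∑ j ∈ Finset.range i, N.len s(q.getVert j, q.getVert (j + 1)) ∧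
        q.getVert i = N.src d ∧ q.getVert (i + 1) = N.tgt d := by
  classical
  induction hn : (Finset.univ.filter fun d : DirArc V => d.1 ≠ N.root ∧ τ ≤ start hS d).card
    using Nat.strong_induction_on generalizing τ u with
  | _ n ih =>
  rcases hτ.eq_or_lt with rfl | hlt
  · rw [apply_tourLength hS] at hu
    obtain rfl := node_injective hu
    exact ⟨SimpleGraph.Walk.nil, by simp, by simp⟩
  · obtain ⟨d, hd, hdτ, rfl⟩ := exists_next hS hlt hu
    have hl := arcLen_pos hd
    set τ' : ℝ≥0 := τ + (N.arcLen d.1).toNNReal with hτ'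
    have hτ'c : (τ' : ℝ) = τ + N.arcLen d.1 := by
      rw [hτ', NNReal.coe_add, Real.coe_toNNReal _ hl.le]
    have hττ' : τ < τ' := by
      rw [← NNReal.coe_lt_coe, hτ'c]
      linarith
    have hτ'le : τ' ≤ N.tourLength := by
      rw [← NNReal.coe_le_coe, hτ'c, ← hdτ]
      exact start_add_le hS hd
    have hu' : S τ' = N.node (N.tgt d) := by
      rw [apply_of_mem hS hd (hdτ ▸ hττ'.le) (by rw [hτ'c, hdτ]), hτ'c, hdτ, add_sub_cancel_left,
        dirPoint_arcLen]
    have hcard : (Finset.univ.filter fun d : DirArc V => d.1 ≠ N.root ∧ τ' ≤ start hS d).card <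
        n := by
      rw [← hn]
      refine Finset.card_lt_card (Finset.ssubset_iff_of_subset ?_ |>.2 ⟨d, ?_, ?_⟩)
      · intro e he
        rw [Finset.mem_filter] at he ⊢
        exact ⟨he.1, he.2.1, hττ'.le.trans he.2.2⟩
      · exact Finset.mem_filter.2 ⟨Finset.mem_univ _, hd, hdτ.ge⟩
      · intro he
        have := (Finset.mem_filter.1 he).2.2
        rw [hdτ] at this
        exact this.not_gt hττ'
    obtain ⟨q, hq1, hq2⟩ := ih _ hcard hτ'le hu' rfl
    have hsum : ∀ i, (τ + ∑ j ∈ Finset.range (i + 1),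
        N.len s((q.cons (adj_dirArc hd)).getVert j, (q.cons (adj_dirArc hd)).getVert (j + 1)) : ℝ) =
        τ' + ∑ j ∈ Finset.range i, N.len s(q.getVert j, q.getVert (j + 1)) := by
      intro i
      rw [Finset.sum_range_succ', hτ'c, ← len_dirArc hd]
      simp only [SimpleGraph.Walk.getVert_cons_succ, SimpleGraph.Walk.getVert_zero]
      ring
    refine ⟨q.cons (adj_dirArc hd), ?_, ?_⟩
    · rw [SimpleGraph.Walk.length_cons, hsum, hq1]
    · rintro (_ | i) hi
      · exact ⟨d, hd, by simp [hdτ], by simp, by simp⟩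
      · rw [SimpleGraph.Walk.length_cons, Nat.add_lt_add_iff_right] at hi
        obtain ⟨d', hd', h1, h2, h3⟩ := hq2 i hi
        exact ⟨d', hd', by rw [h1, hsum], h2, h3⟩

lemma exists_mem_Ico_succ {a : ℕ → ℝ} {x : ℝ} (h0 : a 0 ≤ x) {n : ℕ} (hn : x < a n) :
    ∃ i < n, a i ≤ x ∧ x < a (i + 1) := by
  induction n with
  | zero => exact absurd h0 hn.not_ge
  | succ n ih =>
    by_cases h : x < a n
    · obtain ⟨i, hi, h⟩ := ih h
      exact ⟨i, hi.trans (Nat.lt_succ_self n), h⟩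
    · exact ⟨n, Nat.lt_succ_self n, not_lt.1 h, hn⟩

lemma arrivalTime_mono (p : N.graph.Walk N.root N.root) {i j : ℕ} (hij : i ≤ j)
    (hj : j ≤ p.length) : N.arrivalTime p i ≤ N.arrivalTime p j := by
  refine Finset.sum_le_sum_of_subset_of_nonneg (Finset.range_mono hij) fun k hk _ => ?_
  have : k < p.length := (Finset.mem_range.1 hk).trans_le hj
  exact (N.len_pos _ (p.adj_getVert_succ this)).le

include hS in
/-- A tour is a depth-first search: it leaves a subtree only when the phase of the arc to the
subtree is past the middle, and the search does not come back after that. -/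
lemma IsTour.isDepthFirst : IsDepthFirst S := by
  classical
  refine ⟨hS.1, ?_⟩
  obtain ⟨p, hp1, hp2⟩ := exists_walk_from hS (zero_le : 0 ≤ N.tourLength) hS.1.1
  simp only [NNReal.coe_zero, zero_add] at hp1 hp2
  change N.arrivalTime p p.length = _ at hp1
  have hsucc : ∀ i d, d.1 ≠ N.root → p.getVert i = N.src d → p.getVert (i + 1) = N.tgt d →
      N.arrivalTime p (i + 1) = N.arrivalTime p i + N.arcLen d.1 := by
    intro i d hd h1 h2
    rw [arrivalTime, Finset.sum_range_succ, h1, h2, len_dirArc hd]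
    rfl
  -- every directed arc occurs in the walk
  have hex : ∀ d : DirArc V, d.1 ≠ N.root →
      ∃ i < p.length, N.arrivalTime p i = start hS d ∧ p.getVert i = N.src d ∧
        p.getVert (i + 1) = N.tgt d := by
    intro d hd
    have hl := arcLen_pos hd
    obtain ⟨i, hi, h1, h2⟩ := exists_mem_Ico_succ (a := N.arrivalTime p) (x := start hS d)
      (by simp [arrivalTime]) (n := p.length)
      (by rw [hp1]; exact NNReal.coe_lt_coe.2 (start_lt hS hd))
    obtain ⟨d', hd', hs', hsrc, htgt⟩ := hp2 i hi
    change (start hS d' : ℝ) = N.arrivalTime p i at hs'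
    rw [hsucc i d' hd' hsrc htgt] at h2
    -- a time during the traversals of both arcs
    obtain ⟨t, ht1, ht2⟩ := exists_between
      (lt_min (lt_add_of_pos_right (start hS d : ℝ) hl) h2)
    lift t to ℝ≥0 using (start hS d).coe_nonneg.trans ht1.le
    have : d = d' := eq_of_overlap hS hd hd' (NNReal.coe_lt_coe.1 ht1)
      (ht2.trans_le (min_le_left _ _)) (by rw [← NNReal.coe_lt_coe]; linarith)
      (by rw [hs']; exact ht2.trans_le (min_le_right _ _))
    subst this
    exact ⟨i, hi, hs'.symm, hsrc, htgt⟩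
  refine ⟨p, ⟨?_, ?_⟩, ?_⟩
  · intro u v huv
    obtain ⟨d, hd, rfl, rfl⟩ := exists_dirArc huv
    obtain ⟨i, hi, hst, hsrc, htgt⟩ := hex d hd
    refine ⟨i, ⟨hi, hsrc, htgt⟩, ?_⟩
    rintro j ⟨hj, hjs, hjt⟩
    obtain ⟨d', hd', hs', hsrc', htgt'⟩ := hp2 j hj
    change (start hS d' : ℝ) = N.arrivalTime p j at hs'
    obtain rfl : d = d' := dirArc_injective hd hd' (hjs.symm.trans hsrc') (hjt.symm.trans htgt')
    have hij : N.arrivalTime p i = N.arrivalTime p j := hst.trans hs'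
    have hl := arcLen_pos hd
    rcases lt_trichotomy i j with h | h | h
    · have := arrivalTime_mono p (Nat.succ_le_of_lt h) hj.le
      linarith [hsucc i d hd hsrc htgt]
    · exact h.symm
    · have := arrivalTime_mono p (Nat.succ_le_of_lt h) hi.le
      linarith [hsucc j d hd hjs hjt]
  · intro i hi hdist w hw hwne
    obtain ⟨⟨v, b⟩, hv, hs, hsrc, htgt⟩ := hp2 i hi
    change (start hS (v, b) : ℝ) = N.arrivalTime p i at hs
    have hdep := depth_par hv
    have hb : b = true := by
      by_contra hb
      rw [hsrc, htgt] at hdist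
      simp only [src, tgt, Bool.eq_false_of_not_eq_true hb, Bool.false_eq_true, if_false] at hdist
      change N.depth v < N.depth (N.par v) at hdist
      simp only at hdep
      omega
    subst hb
    simp only [src, tgt, if_true] at hsrc htgt
    simp only at hv
    rw [hsrc] at hw ⊢
    rw [htgt] at hwne
    rcases adj_cases hw with ⟨hw0, hwv⟩ | ⟨-, h⟩
    swap
    · exact absurd h.symm hwne
    obtain ⟨j, hj, hst, hsrc', htgt'⟩ := hex (w, false) hw0
    have hlw := arcLen_pos hw0
    simp only [src, tgt, Bool.false_eq_true, if_false, hwv] at hsrc' htgt'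
    refine ⟨j, ?_, by rw [hsrc', htgt']⟩
    by_contra hij
    have hle : start hS (v, true) ≤ start hS (w, false) := by
      rw [← NNReal.coe_le_coe, hs, ← hst]
      exact arrivalTime_mono p (not_lt.1 hij) hj.le
    -- in the middle of the arc to `w` the arc below `v` would have to be in mid-phase
    have hsw := start_add_le hS (d := (w, false)) hw0
    obtain ⟨t, ht⟩ : ∃ t : ℝ≥0, (t : ℝ) = start hS (w, false) + N.arcLen w / 2 :=
      ⟨⟨_, add_nonneg (NNReal.coe_nonneg _) (half_pos hlw).le⟩, rfl⟩
    have hpw := phase_of_mem hS (d := (w, false)) hw0 (t := t)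
      (by rw [← NNReal.coe_le_coe]; linarith) (by simp only; linarith)
    simp only [base, Bool.false_eq_true, if_false] at hpw
    have hcw : 0 < N.coord w (S t) := by
      rw [coord_eq_phase hS (by linarith)]
      linarith
    have hav : N.Anc v w := (anc_iff hw0).2 (Or.inr (by rw [hwv]; exact anc_self hv))
    have hcv : N.coord v (S t) = N.arcLen v :=
      coord_eq_arcLen hcw hav (fun h => hw.ne h)
    have hpv := (phase_eq_arcLen_iff hS).2 hcv
    have htΛ : t ≤ N.tourLength := by
      rw [← NNReal.coe_le_coe]
      simp only at hsw
      linarith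
    have hts := start_le_of_phase_le hS (d := (v, true)) hv htΛ (by simp [base, hpv])
    rw [← NNReal.coe_le_coe] at hts hle
    linarith
  · intro i hi t ht1 ht2
    obtain ⟨d, hd, hs, hsrc, htgt⟩ := hp2 i hi
    change (start hS d : ℝ) = N.arrivalTime p i at hs
    have hl := arcLen_pos hd
    rw [hsucc i d hd hsrc htgt] at ht2 ⊢
    rw [← hs] at ht1 ht2 ⊢
    have hm : (t : ℝ) - start hS d ∈ Icc 0 (N.arcLen d.1) := ⟨by linarith, by linarith⟩
    rw [apply_of_mem hS hd (NNReal.coe_le_coe.1 ht1) ht2, hsrc, htgt, ← dirPoint_zero,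
      ← dirPoint_arcLen, dist_dirPoint d ⟨le_rfl, hl.le⟩ hm, dist_dirPoint d hm ⟨hl.le, le_rfl⟩]
    refine ⟨?_, ?_⟩
    · rw [zero_sub, abs_neg, abs_of_nonneg hm.1]
    · rw [abs_of_nonpos (by linarith [hm.2])]
      ring

end Runs

/-! ### Optimal searches -/

section Optimal

variable {V : Type*} [Fintype V] [DecidableEq V] {N : TreeNetwork V}

lemma sum_coord_arc {v : V} {r : ℝ} (h0 : 0 ≤ r) (h1 : r ≤ N.arcLen v) :
    ∑ w, N.coord w (N.arc v r) = r + ∑ w, N.coord w (N.node (N.par v)) := by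
  classical
  rw [← arc_zero, ← sub_eq_iff_eq_add, ← Finset.sum_sub_distrib, Finset.sum_eq_single v]
  · rw [coord_arc_self h0 h1, coord_arc_self le_rfl (N.arcLen_nonneg v), sub_zero]
  · intro w _ hw
    rw [coord_arc, coord_arc, if_neg hw, if_neg hw, sub_self]
  · simp

/-- The way back from a point to the root at unit speed. -/
lemma exists_return (x : N.Point) : ∃ γ : ℝ≥0 → N.Point, LipschitzWith 1 γ ∧ γ 0 = x ∧
    ∀ t : ℝ≥0, ∑ v, N.coord v x ≤ t → γ t = N.node N.root := by
  have step : ∀ v, (∃ γ : ℝ≥0 → N.Point, LipschitzWith 1 γ ∧ γ 0 = N.node (N.par v) ∧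
      ∀ t : ℝ≥0, ∑ w, N.coord w (N.node (N.par v)) ≤ t → γ t = N.node N.root) →
      ∀ r, 0 ≤ r → r ≤ N.arcLen v → ∃ γ : ℝ≥0 → N.Point, LipschitzWith 1 γ ∧ γ 0 = N.arc v r ∧
        ∀ t : ℝ≥0, ∑ w, N.coord w (N.arc v r) ≤ t → γ t = N.node N.root := by
    rintro v ⟨γ, hγ, hγ0, hγ1⟩ r h0 h1
    lift r to ℝ≥0 using h0
    have hf : LipschitzWith 1 fun t : ℝ≥0 => N.arc v ((r : ℝ) - t) := by
      refine lipschitzWith_comp (lipschitzWith_arc v) (LipschitzWith.of_dist_le_mul fun a b => ?_)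
      rw [NNReal.coe_one, one_mul, NNReal.dist_eq, Real.dist_eq, sub_sub_sub_cancel_left,
        abs_sub_comm]
    have hg : LipschitzWith 1 fun t : ℝ≥0 => γ (t - r) :=
      lipschitzWith_comp hγ (lipschitzWith_sub_right r)
    have hfg : N.arc v ((r : ℝ) - r) = γ (r - r) := by
      rw [sub_self, tsub_self, hγ0, arc_zero]
    refine ⟨_, lipschitzWith_ite_le hf hg hfg, ?_, ?_⟩
    · simp
    · intro t ht
      rw [sum_coord_arc r.coe_nonneg h1] at ht
      have hnn : 0 ≤ ∑ w, N.coord w (N.node (N.par v)) :=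
        Finset.sum_nonneg fun w _ => coord_nonneg _ _
      have hrt : r ≤ t := by
        rw [← NNReal.coe_le_coe]
        linarith
      refine (ite_le_of_ge (f := fun t : ℝ≥0 => N.arc v ((r : ℝ) - t))
        (g := fun t : ℝ≥0 => γ (t - r)) hfg hrt).trans (hγ1 _ ?_)
      rw [NNReal.coe_sub hrt]
      linarith
  have hnode : ∀ v, ∃ γ : ℝ≥0 → N.Point, LipschitzWith 1 γ ∧ γ 0 = N.node v ∧
      ∀ t : ℝ≥0, ∑ w, N.coord w (N.node v) ≤ t → γ t = N.node N.root := by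
    intro v
    refine N.par_induction (P := fun v => ∃ γ : ℝ≥0 → N.Point, LipschitzWith 1 γ ∧
      γ 0 = N.node v ∧ ∀ t : ℝ≥0, ∑ w, N.coord w (N.node v) ≤ t → γ t = N.node N.root) ?_ ?_ v
    · exact ⟨fun _ => N.node N.root, LipschitzWith.const' _, rfl, fun _ _ => rfl⟩
    · intro v _ ih
      rw [node_eq_arc]
      exact step v ih _ (N.arcLen_nonneg v) le_rfl
  rcases point_cases x with rfl | ⟨v, r, -, h0, h1, rfl⟩
  · exact hnode _
  · exact step v (hnode _) r h0.le h1

/-- A closed set of full measure that contains the path to each of its points is everything: it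
meets every subtree of positive length, hence contains all points but possibly some leaves. -/
lemma IsMonotone.eq_univ_of_isClosed {h : Measure N.Point} [IsProbabilityMeasure h]
    (hmono : IsMonotone h) {C : Set N.Point} (hC : IsClosed C) (hfull : h Cᶜ = 0)
    (hroot : N.node N.root ∈ C) (hlow : ∀ x ∈ C, ∀ y, N.Below y x → y ∈ C) : C = univ := by
  have hint : ∀ v r, 0 < r → r < N.arcLen v → N.arc v r ∈ C := by
    intro v r h0 h1
    by_contra hn
    refine (hmono.measure_subtreeAt_pos (lengthMeasure_subtreeAt_arc_pos h0 h1)).ne' ?_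
    exact measure_mono_null (fun y hy hyC => hn (hlow y hyC _ hy)) hfull
  have hnode : ∀ v, N.node v ∈ C := by
    intro v
    by_cases hv : v = N.root
    · rw [hv]
      exact hroot
    · have hl := arcLen_pos hv
      have hcl : IsClosed (N.arc v ⁻¹' C) := hC.preimage (lipschitzWith_arc v).continuous
      have hsub : Ioo 0 (N.arcLen v) ⊆ N.arc v ⁻¹' C := fun r hr => hint v r hr.1 hr.2
      have := hcl.closure_subset_iff.2 hsub
      rw [closure_Ioo hl.ne] at this
      rw [node_eq_arc]
      exact this (right_mem_Icc.2 hl.le)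
  refine eq_univ_of_forall fun x => ?_
  obtain ⟨v, hv⟩ := exists_below_node x
  exact hlow _ (hnode v) x hv

/-- A search with the minimal expected search time is the beginning of a tour: at the last time `M`
at which it could still return to the root by the end of a tour, it has covered the network. -/
lemma IsMonotone.exists_isTour_of_le {h : Measure N.Point} [IsProbabilityMeasure h]
    (hmono : IsMonotone h) {S : ℝ≥0 → N.Point} (hS : IsSearch S)
    (hle : expectedSearchTime S h ≤ searchValue h) :
    ∃ S', IsTour Finset.univ S' ∧ ∃ M : ℝ≥0, S '' Icc 0 M = univ ∧ ∀ t ≤ M, S t = S' t := by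
  have hc := hS.2.continuous
  have hψ : Continuous fun t : ℝ≥0 => (t : ℝ) + ∑ v, N.coord v (S t) :=
    NNReal.continuous_coe.add (continuous_finsetSum _ fun v _ => (continuous_coord v).comp hc)
  have hnn : ∀ t, 0 ≤ ∑ v, N.coord v (S t) := fun t => Finset.sum_nonneg fun v _ => coord_nonneg _ _
  set K : Set ℝ≥0 := {t | (t : ℝ) + ∑ v, N.coord v (S t) ≤ N.tourLength} with hK
  have hKc : IsClosed K := isClosed_le hψ continuous_const
  have hKsub : K ⊆ Icc 0 N.tourLength := by
    intro t ht
    refine ⟨zero_le, NNReal.coe_le_coe.1 ?_⟩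
    have ht' : (t : ℝ) + ∑ v, N.coord v (S t) ≤ N.tourLength := ht
    linarith [hnn t]
  have hK0 : (0 : ℝ≥0) ∈ K := by
    change ((0 : ℝ≥0) : ℝ) + ∑ v, N.coord v (S 0) ≤ N.tourLength
    simp [hS.1, coord_node_root]
  obtain ⟨M, hM⟩ := (isCompact_Icc.of_isClosed_subset hKc hKsub).exists_isGreatest ⟨0, hK0⟩
  have hMle : (M : ℝ) + ∑ v, N.coord v (S M) ≤ N.tourLength := hM.1
  have hMΛ : M ≤ N.tourLength := (hKsub hM.1).2
  have hcover : S '' Icc 0 M = univ := by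
    refine hmono.eq_univ_of_isClosed (isClosed_image_Icc hc M) ?_ ⟨0, ⟨le_rfl, zero_le⟩, hS.1⟩ ?_
    · refine measure_mono_null ?_ (hmono.ae_searchTime_add_le hS hle)
      intro x hx hx'
      refine hx ?_
      change searchTime S x + N.lengthMeasure {y | N.Below y x} ≤ 2 * N.lengthMeasure univ at hx'
      rw [← coe_tourLength_eq] at hx'
      have hne : searchTime S x ≠ ∞ :=
        ne_top_of_le_ne_top ENNReal.coe_ne_top (le_self_add.trans hx')
      obtain ⟨t, htx, ht, -⟩ := exists_searchTime_eq hc hne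
      refine ⟨t, ⟨zero_le, hM.2 ?_⟩, htx⟩
      change (t : ℝ) + ∑ v, N.coord v (S t) ≤ N.tourLength
      rw [htx]
      rw [ht, lengthMeasure_setOf_below, ← ENNReal.ofReal_coe_nnreal,
        ← ENNReal.ofReal_coe_nnreal, ← ENNReal.ofReal_add t.coe_nonneg (htx ▸ hnn t)] at hx'
      exact (ENNReal.ofReal_le_ofReal_iff N.tourLength.coe_nonneg).1 hx'
    · rintro _ ⟨t, ht, rfl⟩ y hy
      obtain ⟨s, hs, hsy⟩ := exists_visit_of_below hc hS.1 rfl hy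
      exact ⟨s, ⟨zero_le, hs.trans ht.2⟩, hsy⟩
  obtain ⟨γ, hγ, hγ0, hγ1⟩ := exists_return (S M)
  have hg : LipschitzWith 1 fun t : ℝ≥0 => γ (t - M) :=
    lipschitzWith_comp hγ (lipschitzWith_sub_right M)
  have hfg : S M = γ (M - M) := by rw [tsub_self, hγ0]
  refine ⟨fun t => if t ≤ M then S t else γ (t - M), ⟨⟨?_, lipschitzWith_ite_le hS.2 hg hfg⟩,
    ?_, ?_⟩, M, hcover, fun t ht => (if_pos ht).symm⟩
  · simp only [if_pos (zero_le : 0 ≤ M)]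
    exact hS.1
  · change (if N.tourLength ≤ M then S N.tourLength else γ (N.tourLength - M)) = _
    refine (ite_le_of_ge (g := fun t : ℝ≥0 => γ (t - M)) hfg hMΛ).trans (hγ1 _ ?_)
    rw [NNReal.coe_sub hMΛ]
    linarith
  · intro v _
    obtain ⟨t, ht, htv⟩ := (hcover ▸ mem_univ (N.node v) : N.node v ∈ S '' Icc 0 M)
    exact ⟨t, ht.2.trans hMΛ, by simp only [if_pos ht.2]; exact htv⟩

end Optimal

end

end TreeNetwork

theorem mainTheorem1 {V : Type*} [Fintype V] [DecidableEq V] (N : TreeNetwork V)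
    (h : MeasureTheory.Measure N.Point) [MeasureTheory.IsProbabilityMeasure h]
    (hmono : TreeNetwork.IsMonotone h) :
    TreeNetwork.StronglySimplySearchable h := by
  obtain ⟨S₀, hS₀⟩ := N.exists_isTour
  refine ⟨⟨S₀, hS₀.isDepthFirst, hS₀.isOptimal hmono⟩, fun S hS => ?_⟩
  obtain ⟨S', hS', hM⟩ := hmono.exists_isTour_of_le hS.1
    ((hS.2 S₀ hS₀.1).trans (hS₀.expectedSearchTime_le hmono))
  exact ⟨S', hS'.isDepthFirst, hM⟩
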